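/- Definitions. Simplicial complexes are finite and contain the empty face; a subcomplex need not use all vertices. $\Delta^{k}$ is the simplex on $k+1$ vertices, $\partial\Delta^{k}$ is its boundary complex, $*$ denotes the join. For a $(d-1)$-dimensional complex $\Gamma$, let $f_i$ be the number of its $i$-dimensional faces (so $f_{-1}=1$); its $h$-vector $h(\Gamma)=(h_0,\ldots,h_d)$ is defined by $\sum_{i=0}^d h_i x^i=\sum_{i=0}^d f_{i-1}x^i(1-x)^{d-i}$. The complex $\Gamma$ is shellable if it is pure (all facets have dimension $d-1$) and its facets can be ordered $\tau_1,\ldots,\tau_r$ so that for each $1<i\le r$ the complex $\overline{\tau}_i\cap\bigcup_{j<i}\overline{\tau}_j$ is pure of dimension $d-2$, where $\overline{\tau}$ is the set of all subsets of $\tau$. For $0\le a_1,\ldots,a_k\le\infty$, $S(a_1,\ldots,a_k)$ is the set of monomials $x_1^{c_1}\cdots x_k^{c_k}$ with $c_i\le a_i$ for all $i$, and $\infty^r$ stands for $r$ entries equal to $\infty$. A multicomplex is a non-empty set $M$ of such monomials closed under divisibility; $F(M)=(F_0,F_1,\ldots)$, where $F_i$ is the number of elements of $M$ of total degree $i$,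 and $\deg(M)=\max\{\deg\mu:\mu\in M\}$. Theorem. Let $l\ge 1$, $m\ge 0$, $p_1,\ldots,p_m\ge 2$ be integers, let $n=l+\sum_{i=1}^m p_i$, and let $0\le d\le n-m$. If $M\subseteq S(\infty^{n-d-m},p_1-1,\ldots,p_m-1)$ is a multicomplex with $\deg(M)\le d$, then there is a $(d-1)$-dimensional shellable subcomplex $\Gamma$ of $$\Lambda(l;p_1,\ldots,p_m)=\Delta^{l-1}*\partial\Delta^{p_1-1}*\cdots*\partial\Delta^{p_m-1}$$ such that $h(\Gamma)=F(M)$, that is, $h_i=F_i$ for $0\le i\le d$ (and $F_i=0$ for $i>d$). -/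

import Mathlib

open Polynomial

/-- `s` is a face of the simplicial complex `K`, where, as usual in face enumeration, the empty
set counts as a face of every complex (`PreAbstractSimplicialComplex` records only the nonempty
faces). -/
def IsFace {V : Type*} (K : PreAbstractSimplicialComplex V) (s : Finset V) : Prop :=
  s = ∅ ∨ s ∈ K

/-- Subsets of faces are faces. -/
theorem IsFace.subset {V : Type*} {K : PreAbstractSimplicialComplex V} {s t : Finset V}
    (hs : IsFace K s) (hts : t ⊆ s) : IsFace K t := by
  rcases t.eq_empty_or_nonempty with ht | ht
  · exact Or.inl ht
  · rcases hs with rfl | hs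
    · exact Or.inl (Finset.subset_empty.mp hts)
    · exact Or.inr ((K.isRelLowerSet_faces hs).2 hts ht)

/-- A facet is an inclusion-maximal face. -/
def IsFacet {V : Type*} (K : PreAbstractSimplicialComplex V) (s : Finset V) : Prop :=
  Maximal (IsFace K) s

/-- `K` has dimension `k`: the largest value of `|s| - 1` over all faces `s` is `k`. -/
def HasDimension {V : Type*} (K : PreAbstractSimplicialComplex V) (k : ℤ) : Prop :=
  IsGreatest {e : ℤ | ∃ s, IsFace K s ∧ e = (s.card : ℤ) - 1} k

/-- `K` is pure of dimension `k`. -/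
def IsPureOfDimension {V : Type*} (K : PreAbstractSimplicialComplex V) (k : ℤ) : Prop :=
  HasDimension K k ∧ ∀ s, IsFacet K s → (s.card : ℤ) - 1 = k

/-- The complex of all subsets of `τ`. -/
def closedFace {V : Type*} (τ : Finset V) : PreAbstractSimplicialComplex V where
  faces := {s | s.Nonempty ∧ s ⊆ τ}
  isRelLowerSet_faces := fun _ hs => ⟨hs.1, fun _ hts ht => ⟨ht, hts.trans hs.2⟩⟩

/-- The sequence `τ` is a shelling of the complex `K` of dimension `d - 1`: it lists the facets of
`K` without repetition, and every facet after the first meets the union of its predecessors in a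
complex that is pure of dimension `d - 2`. -/
def IsShelling {V : Type*} (K : PreAbstractSimplicialComplex V) (d : ℕ) {r : ℕ}
    (τ : Fin r → Finset V) : Prop :=
  Function.Injective τ ∧ Set.range τ = {s | IsFacet K s} ∧
    ∀ i : Fin r, 0 < (i : ℕ) →
      IsPureOfDimension (closedFace (τ i) ⊓ ⨆ j : Fin r, ⨆ _ : j < i, closedFace (τ j))
        ((d : ℤ) - 2)

/-- `K` is a `(d - 1)`-dimensional shellable complex. -/
def IsShellable {V : Type*} (K : PreAbstractSimplicialComplex V) (d : ℕ) : Prop :=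
  IsPureOfDimension K ((d : ℤ) - 1) ∧ ∃ (r : ℕ) (τ : Fin r → Finset V), IsShelling K d τ

/-- The number of faces of `K` with `i` vertices, that is `f_{i-1}(K)`. -/
noncomputable def faceCount {V : Type*} (K : PreAbstractSimplicialComplex V) (i : ℕ) : ℕ :=
  {s : Finset V | IsFace K s ∧ s.card = i}.ncard

/-- The polynomial `∑_{i=0}^d f_{i-1} x^i (1-x)^{d-i}`. -/
noncomputable def hPolynomial {V : Type*} (K : PreAbstractSimplicialComplex V) (d : ℕ) : ℤ[X] :=
  ∑ i ∈ Finset.range (d + 1), (faceCount K i : ℤ[X]) * X ^ i * (1 - X) ^ (d - i)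

/-- The `h`-vector of a `(d - 1)`-dimensional complex `K` (entries with index above `d` are 0). -/
noncomputable def hVector {V : Type*} (K : PreAbstractSimplicialComplex V) (d : ℕ) (i : ℕ) : ℤ :=
  (hPolynomial K d).coeff i

/-- The simplex with vertex set `V`. -/
def fullSimplex (V : Type*) : PreAbstractSimplicialComplex V := ⊤

/-- The boundary complex of the simplex with vertex set `V`: all proper subsets of `V`. -/
def boundarySimplex (V : Type*) [Fintype V] : PreAbstractSimplicialComplex V where
  faces := {s | s.Nonempty ∧ s ≠ Finset.univ}
  isRelLowerSet_faces := fun _ hs => ⟨hs.1, fun _ hts ht =>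
    ⟨ht, fun h => hs.2 (Finset.univ_subset_iff.mp (h ▸ hts))⟩⟩

/-- The join of two complexes, on the disjoint union of the vertex sets. -/
def join {V W : Type*} (K : PreAbstractSimplicialComplex V) (L : PreAbstractSimplicialComplex W) :
    PreAbstractSimplicialComplex (V ⊕ W) where
  faces := {s | s.Nonempty ∧ IsFace K s.toLeft ∧ IsFace L s.toRight}
  isRelLowerSet_faces := fun _ hs => ⟨hs.1, fun _ hts ht =>
    ⟨ht, hs.2.1.subset (Finset.toLeft_subset_toLeft hts),
      hs.2.2.subset (Finset.toRight_subset_toRight hts)⟩⟩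

/-- The part of `s` in the `i`-th summand of a disjoint union. -/
noncomputable def component {ι : Type*} {V : ι → Type*} (s : Finset (Σ i, V i)) (i : ι) :
    Finset (V i) :=
  s.preimage (Sigma.mk i) sigma_mk_injective.injOn

/-- The join of a family of complexes, on the disjoint union of the vertex sets. -/
def joinFamily {ι : Type*} {V : ι → Type*} (K : ∀ i, PreAbstractSimplicialComplex (V i)) :
    PreAbstractSimplicialComplex (Σ i, V i) where
  faces := {s | s.Nonempty ∧ ∀ i, IsFace (K i) (component s i)}
  isRelLowerSet_faces := fun _ hs => ⟨hs.1, fun _ hts ht =>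
    ⟨ht, fun i => (hs.2 i).subset fun _ hx =>
      Finset.mem_preimage.mpr (hts (Finset.mem_preimage.mp hx))⟩⟩

/-- `Λ(l; p_1, …, p_m) = Δ^{l-1} * ∂Δ^{p_1-1} * ⋯ * ∂Δ^{p_m-1}`. -/
def LambdaComplex (l : ℕ) {m : ℕ} (p : Fin m → ℕ) :
    PreAbstractSimplicialComplex (Fin l ⊕ (Σ i : Fin m, Fin (p i))) :=
  join (fullSimplex (Fin l)) (joinFamily fun i => boundarySimplex (Fin (p i)))

/-- The set `S(a)` of monomials `∏ x_j ^ c_j` with `c_j ≤ a_j`, given by exponent vectors. -/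
def boundedMonomials {σ : Type*} (a : σ → ℕ∞) : Set (σ →₀ ℕ) :=
  {c | ∀ j, (c j : ℕ∞) ≤ a j}

/-- A multicomplex: a nonempty set of monomials closed under divisibility (divisibility of
monomials is the componentwise order of their exponent vectors). -/
def IsMulticomplex {σ : Type*} (M : Set (σ →₀ ℕ)) : Prop :=
  M.Nonempty ∧ ∀ μ μ' : σ →₀ ℕ, μ ≤ μ' → μ' ∈ M → μ ∈ M

/-- `F_i(M)`, the number of monomials of total degree `i` in `M`. -/
noncomputable def FVector {σ : Type*} (M : Set (σ →₀ ℕ)) (i : ℕ) : ℕ :=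
  {μ | μ ∈ M ∧ μ.degree = i}.ncard

/-! Order the vertices block by block, with the unrestricted simplex first. Let `F` be a `d`-set
that contains no boundary block. Of its `n - d` non-elements, `m` are the topmost missing vertices
of their blocks; the other `r = n - d - m` are its gaps. Encode `F` as a monomial: `x_t` counts the
free elements of `F` with exactly `t` gaps above them, and `y_i` counts the elements of block `i`
above its topmost missing vertex. This identifies such `d`-sets with the monomials of degree at most
`d` whose exponent in each `y_i` is below `p_i` (`restrictionMonomial_injOn`,
`exists_restrictionMonomial_eq`). The degree of the monomial is the size of the restriction set,
which omits only the free elements below every gap.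

In colex order these restriction sets behave as in a shelling, provided that the chosen family is
closed under exchanging an element of the restriction set for a suitable smaller vertex. Such an
exchange either lowers the monomial or moves some of its exponent from one variable to a heavier
one, in the order `y_i < x_0 < x_1 < ...`. Hence the facets encoded by a multicomplex stable under
these moves form a shellable complex with `h_i = F_i`.

Stability costs nothing: compressing one pair of variables preserves the multicomplex property and
the `F`-vector, and a multicomplex of maximal total weight is stable (`exists_stable_multicomplex`).
Bounds survive because exponents grow only in unbounded variables. -/

/-! ### Complexes generated by facets of equal size -/

/-- The simplicial complex generated by a family of finite sets. -/
def generatedComplex {V : Type*} (𝓕 : Finset (Finset V)) : PreAbstractSimplicialComplex V where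
  faces := {s | s.Nonempty ∧ ∃ F ∈ 𝓕, s ⊆ F}
  isRelLowerSet_faces := fun _ hs => ⟨hs.1, fun _ hts ht =>
    ⟨ht, hs.2.imp fun _ hF => ⟨hF.1, hts.trans hF.2⟩⟩⟩

theorem isFace_generatedComplex {V : Type*} {𝓕 : Finset (Finset V)} (hne : 𝓕.Nonempty)
    {s : Finset V} : IsFace (generatedComplex 𝓕) s ↔ ∃ F ∈ 𝓕, s ⊆ F := by
  constructor
  · rintro (rfl | hs)
    · exact hne.imp fun F hF => ⟨hF, Finset.empty_subset _⟩
    · exact hs.2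
  · intro h
    rcases s.eq_empty_or_nonempty with hs | hs
    · exact Or.inl hs
    · exact Or.inr ⟨hs, h⟩

theorem isFacet_generatedComplex {V : Type*} {𝓕 : Finset (Finset V)} (hne : 𝓕.Nonempty) {d : ℕ}
    (hd : ∀ F ∈ 𝓕, F.card = d) {s : Finset V} : IsFacet (generatedComplex 𝓕) s ↔ s ∈ 𝓕 := by
  constructor
  · intro h
    obtain ⟨F, hF, hsF⟩ := (isFace_generatedComplex hne).1 h.prop
    rwa [h.eq_of_le ((isFace_generatedComplex hne).2 ⟨F, hF, subset_rfl⟩) hsF]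
  · intro h
    refine ⟨(isFace_generatedComplex hne).2 ⟨s, h, subset_rfl⟩, fun t ht hst => ?_⟩
    obtain ⟨F, hF, htF⟩ := (isFace_generatedComplex hne).1 ht
    have : s = F := Finset.eq_of_subset_of_card_le (hst.trans htF) (by rw [hd F hF, hd s h])
    exact this ▸ htF

theorem isPureOfDimension_generatedComplex {V : Type*} {𝓕 : Finset (Finset V)}
    (hne : 𝓕.Nonempty) {d : ℕ} (hd : ∀ F ∈ 𝓕, F.card = d) :
    IsPureOfDimension (generatedComplex 𝓕) ((d : ℤ) - 1) := by
  refine ⟨⟨?_, ?_⟩, fun s hs => ?_⟩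
  · obtain ⟨F, hF⟩ := hne
    exact ⟨F, (isFace_generatedComplex ⟨F, hF⟩).2 ⟨F, hF, subset_rfl⟩, by rw [hd F hF]⟩
  · rintro e ⟨s, hs, rfl⟩
    obtain ⟨F, hF, hsF⟩ := (isFace_generatedComplex hne).1 hs
    have := Finset.card_le_card hsF
    rw [hd F hF] at this
    omega
  · rw [hd s ((isFacet_generatedComplex hne hd).1 hs)]

theorem mem_iSup_closedFace {V : Type*} {r : ℕ} (τ : Fin r → Finset V) (i : Fin r)
    {s : Finset V} :
    s ∈ (⨆ j : Fin r, ⨆ _ : j < i, closedFace (τ j)) ↔ s.Nonempty ∧ ∃ j < i, s ⊆ τ j := by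
  constructor
  · intro h
    let K : PreAbstractSimplicialComplex V :=
      ⟨{s | s.Nonempty ∧ ∃ j < i, s ⊆ τ j}, fun _ hs => ⟨hs.1, fun _ hts ht =>
        ⟨ht, hs.2.imp fun _ hF => ⟨hF.1, hts.trans hF.2⟩⟩⟩⟩
    have : (⨆ j : Fin r, ⨆ _ : j < i, closedFace (τ j)) ≤ K :=
      iSup₂_le fun j hj s hs => ⟨hs.1, j, hj, hs.2⟩
    exact this h
  · rintro ⟨h, j, hj, hs⟩
    have : closedFace (τ j) ≤ (⨆ j : Fin r, ⨆ _ : j < i, closedFace (τ j)) :=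
      le_iSup₂_of_le j hj le_rfl
    exact this ⟨h, hs⟩

theorem isFace_closedFace_inf_iSup {V : Type*} {r : ℕ} (τ : Fin r → Finset V) (i : Fin r)
    (hi : 0 < (i : ℕ)) {s : Finset V} :
    IsFace (closedFace (τ i) ⊓ ⨆ j : Fin r, ⨆ _ : j < i, closedFace (τ j)) s ↔
      s ⊆ τ i ∧ ∃ j < i, s ⊆ τ j := by
  constructor
  · rintro (rfl | ⟨h₁, h₂⟩)
    · exact ⟨Finset.empty_subset _, ⟨0, by omega⟩, hi, Finset.empty_subset _⟩
    · exact ⟨h₁.2, ((mem_iSup_closedFace τ i).1 h₂).2⟩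
  · rintro ⟨h₁, h₂⟩
    rcases s.eq_empty_or_nonempty with hs | hs
    · exact Or.inl hs
    · exact Or.inr ⟨⟨hs, h₁⟩, (mem_iSup_closedFace τ i).2 ⟨hs, h₂⟩⟩

/-! ### Restriction maps, shellings and `h`-vectors -/

/-- A family of `d`-sets with restriction sets `R F`, ordered colexicographically, satisfying the
two conditions which characterise the restriction map of a shelling. -/
structure IsRestrictionMap {V : Type*} [LinearOrder V] (𝓕 : Finset (Finset V)) (d : ℕ)
    (R : Finset V → Finset V) : Prop where
  nonempty : 𝓕.Nonempty
  card_eq : ∀ F ∈ 𝓕, F.card = d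
  subset : ∀ F ∈ 𝓕, R F ⊆ F
  le_of_subset : ∀ F ∈ 𝓕, ∀ G ∈ 𝓕, R F ⊆ G → toColex F ≤ toColex G
  exchange : ∀ F ∈ 𝓕, ∀ v ∈ R F, ∃ G ∈ 𝓕, toColex G < toColex F ∧ F.erase v ⊆ G

namespace IsRestrictionMap

variable {V : Type*} [LinearOrder V] {𝓕 : Finset (Finset V)} {d : ℕ} {R : Finset V → Finset V}

/-- Take the colex-first member containing `s`. If an element of its restriction set lay outside
`s`, exchanging it would give an earlier member containing `s`. -/
theorem exists_mem_Icc (h : IsRestrictionMap 𝓕 d R) {s F : Finset V} (hF : F ∈ 𝓕) (hs : s ⊆ F) :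
    ∃ G ∈ 𝓕, R G ⊆ s ∧ s ⊆ G := by
  obtain ⟨G, hG, hmin⟩ := Finset.exists_min_image (𝓕.filter (s ⊆ ·)) toColex
    ⟨F, by simp [hF, hs]⟩
  simp only [Finset.mem_filter, and_imp] at hG hmin
  refine ⟨G, hG.1, fun v hv => ?_, hG.2⟩
  by_contra hvs
  obtain ⟨G', hG', hlt, hsub⟩ := h.exchange G hG.1 v hv
  exact (hmin G' hG' ((Finset.subset_erase.2 ⟨hG.2, hvs⟩).trans hsub)).not_gt hlt

theorem eq_of_mem_Icc (h : IsRestrictionMap 𝓕 d R) {s F G : Finset V} (hF : F ∈ 𝓕) (hG : G ∈ 𝓕)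
    (hFs : R F ⊆ s) (hsF : s ⊆ F) (hGs : R G ⊆ s) (hsG : s ⊆ G) : F = G :=
  toColex_inj.1 (le_antisymm (h.le_of_subset F hF G hG (hFs.trans hsG))
    (h.le_of_subset G hG F hF (hGs.trans hsF)))

/-- The intersection of `τ i` with its predecessors is generated by the ridges `(τ i).erase v` with
`v ∈ R (τ i)`: `exchange` puts each ridge in a predecessor, and by `le_of_subset` a face shared with
a predecessor cannot contain all of `R (τ i)`. -/
theorem isShelling (h : IsRestrictionMap 𝓕 d R) {r : ℕ} (τ : Fin r → Finset V)
    (hτ : StrictMono fun i => toColex (τ i)) (hrange : ∀ F, F ∈ 𝓕 ↔ ∃ i, τ i = F) :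
    IsShelling (generatedComplex 𝓕) d τ := by
  have hmem : ∀ i, τ i ∈ 𝓕 := fun i => (hrange _).2 ⟨i, rfl⟩
  refine ⟨fun i j hij => hτ.injective (congrArg toColex hij), ?_, fun i hi => ?_⟩
  · ext F
    rw [Set.mem_ofPred_eq, isFacet_generatedComplex h.nonempty h.card_eq, hrange, Set.mem_range]
  · have hface := fun s => isFace_closedFace_inf_iSup τ i hi (s := s)
    have herase : ∀ v ∈ R (τ i), ∃ j < i, (τ i).erase v ⊆ τ j := by
      intro v hv
      obtain ⟨G, hG, hlt, hsub⟩ := h.exchange _ (hmem i) v hv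
      obtain ⟨j, rfl⟩ := (hrange G).1 hG
      exact ⟨j, hτ.lt_iff_lt.1 hlt, hsub⟩
    have hmax : ∀ s, s ⊆ τ i → (∃ j < i, s ⊆ τ j) → ∃ v ∈ R (τ i), s ⊆ (τ i).erase v := by
      rintro s hs ⟨j, hj, hsj⟩
      by_contra! hcon
      refine (h.le_of_subset _ (hmem i) _ (hmem j) fun v hv => hsj ?_).not_gt (hτ hj)
      by_contra hvs
      exact hcon v hv (Finset.subset_erase.2 ⟨hs, hvs⟩)
    have hcard : ∀ v ∈ R (τ i), (((τ i).erase v).card : ℤ) - 1 = (d : ℤ) - 2 := by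
      intro v hv
      have hv' := h.subset _ (hmem i) hv
      have hpos := Finset.card_pos.2 ⟨v, hv'⟩
      rw [Finset.card_erase_of_mem hv', h.card_eq _ (hmem i)] at *
      omega
    refine ⟨⟨?_, ?_⟩, fun s hs => ?_⟩
    -- The empty face is shared with the first facet, so `R (τ i)` is nonempty and the dimension `d
    -- - 2` is attained.
    · obtain ⟨v, hv, -⟩ := hmax ∅ (Finset.empty_subset _)
        ⟨⟨0, by omega⟩, hi, Finset.empty_subset _⟩
      exact ⟨_, (hface _).2 ⟨Finset.erase_subset _ _, herase v hv⟩, (hcard v hv).symm⟩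
    · rintro e ⟨s, hs, rfl⟩
      obtain ⟨v, hv, hsv⟩ := hmax s ((hface s).1 hs).1 ((hface s).1 hs).2
      have := Finset.card_le_card hsv
      have := hcard v hv
      omega
    · obtain ⟨v, hv, hsv⟩ := hmax s ((hface s).1 hs.prop).1 ((hface s).1 hs.prop).2
      rw [hs.eq_of_le ((hface _).2 ⟨Finset.erase_subset _ _, herase v hv⟩) hsv, hcard v hv]

theorem isShellable (h : IsRestrictionMap 𝓕 d R) : IsShellable (generatedComplex 𝓕) d := by
  refine ⟨isPureOfDimension_generatedComplex h.nonempty h.card_eq, _,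
    fun i => ofColex ((𝓕.map toColex.toEmbedding).orderEmbOfFin rfl i),
    h.isShelling _ (fun i j hij => ?_) fun F => ?_⟩
  · simpa using hij
  · have := Finset.range_orderEmbOfFin (𝓕.map toColex.toEmbedding) rfl
    have := Set.ext_iff.1 this (toColex F)
    simp only [Set.mem_range, SetLike.mem_coe, Finset.mem_map_equiv] at this
    rw [← ofColex_toColex F, ← toColex_symm_eq, ← this]
    rfl

theorem sum_Icc_pow (S F : Finset V) (hSF : S ⊆ F) :
    ∑ s ∈ Finset.Icc S F, (X : ℤ[X]) ^ s.card * (1 - X) ^ (F.card - s.card) = X ^ S.card := by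
  have hdisj : ∀ t ∈ (F \ S).powerset, Disjoint S t := fun t ht =>
    Finset.disjoint_sdiff.mono_right (Finset.mem_powerset.1 ht)
  rw [Finset.Icc_eq_image_powerset hSF, Finset.sum_image]
  · have := Finset.sum_pow_mul_eq_add_pow (X : ℤ[X]) (1 - X) (F \ S)
    rw [add_sub_cancel, one_pow] at this
    conv_rhs => rw [← mul_one (X ^ S.card), ← this, Finset.mul_sum]
    refine Finset.sum_congr rfl fun t ht => ?_
    rw [Finset.card_union_of_disjoint (hdisj t ht), Finset.card_sdiff_of_subset hSF, pow_add,
      mul_assoc, Nat.sub_add_eq]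
  · intro t ht t' ht' heq
    rw [← Finset.union_sdiff_cancel_left (hdisj t ht),
      ← Finset.union_sdiff_cancel_left (hdisj t' ht')]
    exact congrArg (· \ S) heq

/-- The intervals from `R F` to `F` partition the faces, and by the binomial theorem for `X + (1 -
X) = 1` each contributes the single power `X ^ |R F|`. -/
theorem hPolynomial_eq [Fintype V] (h : IsRestrictionMap 𝓕 d R) :
    hPolynomial (generatedComplex 𝓕) d = ∑ F ∈ 𝓕, (X : ℤ[X]) ^ (R F).card := by
  have hfaces : ∀ s, IsFace (generatedComplex 𝓕) s ↔
      s ∈ 𝓕.biUnion fun F => Finset.Icc (R F) F := by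
    intro s
    simp only [isFace_generatedComplex h.nonempty, Finset.mem_biUnion, Finset.mem_Icc]
    exact ⟨fun ⟨F, hF, hs⟩ => h.exists_mem_Icc hF hs, fun ⟨F, hF, hs⟩ => ⟨F, hF, hs.2⟩⟩
  have hcount : ∀ i, faceCount (generatedComplex 𝓕) i =
      ((𝓕.biUnion fun F => Finset.Icc (R F) F).filter fun s => s.card = i).card := by
    intro i
    rw [faceCount, ← Set.ncard_coe_finset]
    congr 1
    ext s
    simp [hfaces s]
  have hmaps : ∀ s ∈ 𝓕.biUnion fun F => Finset.Icc (R F) F, s.card ∈ Finset.range (d + 1) := by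
    intro s hs
    obtain ⟨F, hF, hsF⟩ := (isFace_generatedComplex h.nonempty).1 ((hfaces s).2 hs)
    rw [Finset.mem_range_succ_iff, ← h.card_eq F hF]
    exact Finset.card_le_card hsF
  have hdisj : (𝓕 : Set (Finset V)).PairwiseDisjoint fun F => Finset.Icc (R F) F := by
    intro F hF G hG hne
    refine Finset.disjoint_left.2 fun s hsF hsG => hne ?_
    rw [Finset.mem_Icc] at hsF hsG
    exact h.eq_of_mem_Icc hF hG hsF.1 hsF.2 hsG.1 hsG.2
  rw [hPolynomial]
  calc _ = ∑ i ∈ Finset.range (d + 1),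
        ∑ s ∈ (𝓕.biUnion fun F => Finset.Icc (R F) F) with s.card = i,
          (X : ℤ[X]) ^ s.card * (1 - X) ^ (d - s.card) := by
        refine Finset.sum_congr rfl fun i _ => ?_
        rw [Finset.sum_congr rfl fun s hs => by rw [(Finset.mem_filter.1 hs).2],
          Finset.sum_const, hcount, nsmul_eq_mul, mul_assoc]
    _ = _ := by
        rw [Finset.sum_fiberwise_of_maps_to hmaps, Finset.sum_biUnion hdisj]
        refine Finset.sum_congr rfl fun F hF => ?_
        rw [← h.card_eq F hF, sum_Icc_pow _ _ (h.subset F hF)]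

theorem hVector_eq [Fintype V] (h : IsRestrictionMap 𝓕 d R) (i : ℕ) :
    hVector (generatedComplex 𝓕) d i = ((𝓕.filter fun F => (R F).card = i).card : ℤ) := by
  rw [hVector, h.hPolynomial_eq, finsetSum_coeff]
  simp [coeff_X_pow, eq_comm]

end IsRestrictionMap

/-! ### Compression of multicomplexes -/

open Classical in
/-- The monomial with exponent `s` at `x` which agrees with `μ` away from `x` and `y` and has the
same total degree (provided `s ≤ μ x + μ y`). -/
noncomputable def shiftTo {σ : Type*} [Finite σ] (x y : σ) (μ : σ →₀ ℕ) (s : ℕ) : σ →₀ ℕ :=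
  Finsupp.equivFunOnFinite.symm fun z => if z = x then s else if z = y then μ x + μ y - s else μ z

section shiftTo

variable {σ : Type*} [Finite σ] {x y : σ}

theorem shiftTo_apply_left (μ : σ →₀ ℕ) (s : ℕ) : shiftTo x y μ s x = s := by
  simp [shiftTo]

theorem shiftTo_apply_right (hxy : x ≠ y) (μ : σ →₀ ℕ) (s : ℕ) :
    shiftTo x y μ s y = μ x + μ y - s := by
  simp [shiftTo, hxy.symm]

theorem shiftTo_apply_of_ne {z : σ} (hx : z ≠ x) (hy : z ≠ y) (μ : σ →₀ ℕ) (s : ℕ) :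
    shiftTo x y μ s z = μ z := by
  simp [shiftTo, hx, hy]

theorem shiftTo_self (hxy : x ≠ y) (μ : σ →₀ ℕ) : shiftTo x y μ (μ x) = μ := by
  ext z
  by_cases hx : z = x
  · rw [hx, shiftTo_apply_left]
  by_cases hy : z = y
  · rw [hy, shiftTo_apply_right hxy]; omega
  · rw [shiftTo_apply_of_ne hx hy]

theorem shiftTo_shiftTo (hxy : x ≠ y) (μ : σ →₀ ℕ) {s : ℕ} (hs : s ≤ μ x + μ y) (t : ℕ) :
    shiftTo x y (shiftTo x y μ s) t = shiftTo x y μ t := by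
  ext z
  by_cases hx : z = x
  · rw [hx, shiftTo_apply_left, shiftTo_apply_left]
  by_cases hy : z = y
  · rw [hy, shiftTo_apply_right hxy, shiftTo_apply_right hxy, shiftTo_apply_left,
      shiftTo_apply_right hxy]; omega
  · rw [shiftTo_apply_of_ne hx hy, shiftTo_apply_of_ne hx hy, shiftTo_apply_of_ne hx hy]

theorem shiftTo_add_single (hxy : x ≠ y) (μ : σ →₀ ℕ) {s : ℕ} (hs : s ≤ μ x) :
    shiftTo x y μ s + Finsupp.single x (μ x - s) = μ + Finsupp.single y (μ x - s) := by
  ext z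
  simp only [Finsupp.add_apply]
  by_cases hx : z = x
  · subst hx
    rw [shiftTo_apply_left, Finsupp.single_eq_same, Finsupp.single_eq_of_ne hxy]; omega
  by_cases hy : z = y
  · subst hy
    rw [shiftTo_apply_right hxy, Finsupp.single_eq_same, Finsupp.single_eq_of_ne hx]; omega
  · rw [shiftTo_apply_of_ne hx hy, Finsupp.single_eq_of_ne hx, Finsupp.single_eq_of_ne hy]

theorem degree_shiftTo (hxy : x ≠ y) (μ : σ →₀ ℕ) {s : ℕ} (hs : s ≤ μ x) :
    (shiftTo x y μ s).degree = μ.degree := by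
  have := congrArg Finsupp.degree (shiftTo_add_single hxy μ hs)
  simp only [map_add, Finsupp.degree_single] at this
  omega

theorem weight_shiftTo (hxy : x ≠ y) (w : σ → ℕ) (μ : σ →₀ ℕ) {s : ℕ} (hs : s ≤ μ x) :
    Finsupp.weight w (shiftTo x y μ s) + (μ x - s) * w x =
      Finsupp.weight w μ + (μ x - s) * w y := by
  have := congrArg (Finsupp.weight w) (shiftTo_add_single hxy μ hs)
  simpa only [map_add, Finsupp.weight_single, smul_eq_mul] using this

theorem shiftTo_le_shiftTo (hxy : x ≠ y) {μ ν : σ →₀ ℕ} (h : μ ≤ ν) {s t : ℕ} (hst : s ≤ t)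
    (ht : μ x + μ y + t ≤ ν x + ν y + s) : shiftTo x y μ s ≤ shiftTo x y ν t := by
  intro z
  by_cases hx : z = x
  · rw [hx, shiftTo_apply_left, shiftTo_apply_left]; exact hst
  by_cases hy : z = y
  · rw [hy, shiftTo_apply_right hxy, shiftTo_apply_right hxy]; omega
  · rw [shiftTo_apply_of_ne hx hy, shiftTo_apply_of_ne hx hy]; exact h z

end shiftTo

section compress

variable {σ : Type*} [Finite σ]

open Classical in
/-- The number of `s < n` for which the monomial `shiftTo x y μ s` belongs to `M`. -/
noncomputable def slotCount (M : Set (σ →₀ ℕ)) (x y : σ) (μ : σ →₀ ℕ) (n : ℕ) : ℕ :=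
  Nat.count (fun s => shiftTo x y μ s ∈ M) n

/-- The compression of `M` which replaces `x` by `y` as far as possible. -/
def compress (M : Set (σ →₀ ℕ)) (x y : σ) : Set (σ →₀ ℕ) :=
  {μ | μ x < slotCount M x y μ (μ x + μ y + 1)}

/-- The bijection from `M` to its compression. -/
noncomputable def compressMap (M : Set (σ →₀ ℕ)) (x y : σ) (μ : σ →₀ ℕ) : σ →₀ ℕ :=
  shiftTo x y μ (slotCount M x y μ (μ x))

variable {M : Set (σ →₀ ℕ)} {x y : σ}

theorem slotCount_le (μ : σ →₀ ℕ) (n : ℕ) : slotCount M x y μ n ≤ n := by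
  classical exact Nat.count_le _

theorem slotCount_shiftTo (hxy : x ≠ y) (μ : σ →₀ ℕ) {s : ℕ} (hs : s ≤ μ x + μ y) :
    slotCount M x y (shiftTo x y μ s) = slotCount M x y μ := by
  classical
  funext n
  simp only [slotCount, shiftTo_shiftTo hxy μ hs]

/-- Monomials that agree off `x` and `y` and have the same total exponent there form a fibre,
indexed by the exponent of `x`. The map sends the `k`-th occupied position of a fibre, counting from
0, to position `k`; `Nat.nth` inverts it. -/
theorem bijOn_compressMap (hxy : x ≠ y) : Set.BijOn (compressMap M x y) M (compress M x y) := by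
  classical
  have hle : ∀ μ : σ →₀ ℕ, slotCount M x y μ (μ x) ≤ μ x + μ y := fun μ =>
    (slotCount_le μ _).trans (Nat.le_add_right _ _)
  have htot : ∀ (μ : σ →₀ ℕ) (s : ℕ), s ≤ μ x + μ y →
      shiftTo x y μ s x + shiftTo x y μ s y = μ x + μ y := by
    intro μ s hs
    rw [shiftTo_apply_left, shiftTo_apply_right hxy]; omega
  refine ⟨fun μ hμ => ?_, fun μ hμ ν hν h => ?_, fun κ hκ => ?_⟩
  · change shiftTo x y μ _ x < _
    rw [compressMap, slotCount_shiftTo hxy μ (hle μ), htot μ _ (hle μ), shiftTo_apply_left]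
    exact Nat.count_strict_mono (by rwa [shiftTo_self hxy]) (by omega)
  · have hslot : ∀ s, shiftTo x y μ s = shiftTo x y ν s := fun s => by
      rw [← shiftTo_shiftTo hxy μ (hle μ), ← shiftTo_shiftTo hxy ν (hle ν)]
      exact congrArg (shiftTo x y · s) h
    have hx := DFunLike.congr_fun h x
    simp only [compressMap, shiftTo_apply_left] at hx
    have : μ x = ν x := by
      simp only [slotCount, hslot] at hx
      refine Nat.count_injective (p := fun s => shiftTo x y ν s ∈ M) ?_ ?_ hx
      · rwa [← hslot, shiftTo_self hxy]
      · rwa [shiftTo_self hxy]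
    rw [← shiftTo_self hxy μ, hslot, this, shiftTo_self hxy]
  · have hκ' : κ x < Nat.count (fun s => shiftTo x y κ s ∈ M) (κ x + κ y + 1) := hκ
    have hs := Nat.nth_lt_of_lt_count hκ'
    have hcard : ∀ hf : (Set.ofPred fun s => shiftTo x y κ s ∈ M).Finite,
        κ x < hf.toFinset.card := fun hf => hκ'.trans_le (by
      rw [Nat.count_eq_card_filter_range]
      exact Finset.card_le_card fun s hs => by simpa using (Finset.mem_filter.1 hs).2)
    have hmem := Nat.nth_mem (p := fun s => shiftTo x y κ s ∈ M) _ hcard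
    have hcount := Nat.count_nth (p := fun s => shiftTo x y κ s ∈ M) hcard
    refine ⟨_, hmem, ?_⟩
    rw [compressMap, slotCount_shiftTo hxy _ (by omega), shiftTo_apply_left,
      shiftTo_shiftTo hxy _ (by omega), slotCount, hcount, shiftTo_self hxy]

/-- Membership in the compression depends only on how many positions of a fibre are occupied, so it
suffices to compare the counts in the fibres of `μ` and `ν`. Divisibility sends an occupied position
`s` of the fibre of `ν` to position `s` for `μ`, and, when `z` is `x` or `y`, also position `s + 1`
to `s`. -/
theorem mem_compress_of_add_single (hM : IsMulticomplex M) (hxy : x ≠ y) (z : σ) (μ : σ →₀ ℕ)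
    (h : μ + Finsupp.single z 1 ∈ compress M x y) : μ ∈ compress M x y := by
  classical
  set ν := μ + Finsupp.single z 1 with hν
  have hμν : μ ≤ ν := le_self_add
  have h₁ : ∀ s, shiftTo x y ν s ∈ M → shiftTo x y μ s ∈ M := fun s hs =>
    hM.2 _ _ (shiftTo_le_shiftTo hxy hμν le_rfl
      (Nat.add_le_add_right (Nat.add_le_add (hμν x) (hμν y)) s)) hs
  have h₂ : z = x ∨ z = y → ∀ s, shiftTo x y ν (s + 1) ∈ M → shiftTo x y μ s ∈ M := by
    intro hz s hs
    refine hM.2 _ _ (shiftTo_le_shiftTo hxy hμν (Nat.le_succ s) ?_) hs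
    rcases hz with rfl | rfl <;> simp [hν, hxy, hxy.symm] <;> omega
  change ν x < Nat.count (fun s => shiftTo x y ν s ∈ M) _ at h
  change μ x < Nat.count (fun s => shiftTo x y μ s ∈ M) _
  -- Dropping position 0 and shifting the rest down loses at most one element, matching the drop of
  -- the exponent of `x` by one.
  by_cases hx : z = x
  · have e₁ : ν x = μ x + 1 := by simp [hν, hx]
    have e₂ : ν y = μ y := by simp [hν, hx, hxy.symm]
    rw [e₁, e₂, Nat.count_succ'] at h
    have := Nat.count_mono_left (n := μ x + 1 + μ y) fun k _ => h₂ (Or.inl hx) k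
    rw [add_right_comm] at this
    rw [add_right_comm] at h
    split_ifs at h <;> omega
  by_cases hy : z = y
  · have e₁ : ν x = μ x := by simp [hν, hy, hxy]
    have e₂ : ν y = μ y + 1 := by simp [hν, hy]
    rw [e₁, e₂] at h
    -- The fibre of `ν` has one more position, so its count could be larger only if the fibre of `μ`
    -- were full, and then the claim is trivial. Otherwise a hole at `s` forces holes at `s` and `s
    -- + 1` for `ν`; positions below `s` inject unchanged and those above `s + 1` inject after a
    -- shift by one.
    by_cases hall : ∀ s < μ x + μ y + 1, shiftTo x y μ s ∈ M
    · rw [Nat.count_iff_forall.2 hall]; omega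
    push Not at hall
    obtain ⟨s, hs, hsM⟩ := hall
    obtain ⟨j, hj⟩ := Nat.exists_eq_add_of_le (Nat.lt_succ_iff.1 hs)
    refine h.trans_le ?_
    rw [show μ x + (μ y + 1) + 1 = (s + 1 + 1) + j by omega,
      show μ x + μ y + 1 = (s + 1) + j by omega, Nat.count_add _ (s + 1 + 1) j,
      Nat.count_add _ (s + 1) j,
      Nat.count_succ _ (s + 1), Nat.count_succ _ s, Nat.count_succ _ s, if_neg hsM,
      if_neg fun h' => hsM (h₁ s h'), if_neg fun h' => hsM (h₂ (Or.inr hy) s h')]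
    refine Nat.add_le_add (Nat.count_mono_left fun k _ => h₁ k) (Nat.count_mono_left fun k _ hk => ?_)
    exact h₂ (Or.inr hy) _ (by convert hk using 2; omega)
  · have e₁ : ν x = μ x := by simp [hν, Ne.symm hx]
    have e₂ : ν y = μ y := by simp [hν, Ne.symm hy]
    rw [e₁, e₂] at h
    exact h.trans_le (Nat.count_mono_left fun k _ => h₁ k)

theorem isMulticomplex_compress (hM : IsMulticomplex M) (hxy : x ≠ y) :
    IsMulticomplex (compress M x y) := by
  refine ⟨?_, fun μ μ' hle h => ?_⟩
  · obtain ⟨μ, hμ⟩ := hM.1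
    exact ⟨_, (bijOn_compressMap hxy).mapsTo hμ⟩
  · obtain ⟨δ, rfl⟩ := exists_add_of_le hle
    clear hle
    induction δ using Finsupp.induction_linear generalizing μ with
    | zero => simpa using h
    | add f g hf hg => exact hf _ (hg _ (by rwa [add_assoc]))
    | single z n =>
      induction n with
      | zero => simpa using h
      | succ n ih =>
        refine ih (mem_compress_of_add_single hM hxy z _ ?_)
        rwa [add_assoc, ← Finsupp.single_add]

theorem degree_compressMap (hxy : x ≠ y) (μ : σ →₀ ℕ) :
    (compressMap M x y μ).degree = μ.degree :=
  degree_shiftTo hxy μ (slotCount_le μ _)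

theorem FVector_compress (hxy : x ≠ y) (i : ℕ) : FVector (compress M x y) i = FVector M i := by
  have hbij := bijOn_compressMap (M := M) hxy
  rw [FVector, FVector,
    ← (hbij.injOn.mono fun μ (hμ : μ ∈ {μ | μ ∈ M ∧ μ.degree = i}) => hμ.1).ncard_image]
  congr 1
  ext κ
  constructor
  · rintro ⟨hκ, rfl⟩
    obtain ⟨μ, hμ, rfl⟩ := hbij.surjOn hκ
    exact ⟨μ, ⟨hμ, (degree_compressMap hxy μ).symm⟩, rfl⟩
  · rintro ⟨μ, ⟨hμ, rfl⟩, rfl⟩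
    exact ⟨hbij.mapsTo hμ, degree_compressMap hxy μ⟩

theorem compress_subset_boundedMonomials (hxy : x ≠ y) {a : σ → ℕ∞} (hy : a y = ⊤)
    (hM : M ⊆ boundedMonomials a) : compress M x y ⊆ boundedMonomials a := by
  intro κ hκ z
  obtain ⟨μ, hμ, rfl⟩ := (bijOn_compressMap hxy).surjOn hκ
  by_cases hzx : z = x
  · subst hzx
    rw [compressMap, shiftTo_apply_left]
    exact (Nat.cast_le.2 (slotCount_le μ _)).trans (hM hμ z)
  by_cases hzy : z = y
  · rw [hzy, hy]; exact le_top
  · rw [compressMap, shiftTo_apply_of_ne hzx hzy]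
    exact hM hμ z

/-- Every finite multicomplex has the same `F`-vector as one which is closed under replacing a
variable by an unbounded variable of larger weight. -/
theorem exists_stable_multicomplex (hM : IsMulticomplex M) {d : ℕ} (hMd : ∀ μ ∈ M, μ.degree ≤ d)
    {a : σ → ℕ∞} (hMa : M ⊆ boundedMonomials a) (w : σ → ℕ) (hw : ∀ y, 0 < w y → a y = ⊤) :
    ∃ N : Set (σ →₀ ℕ), IsMulticomplex N ∧ (∀ μ ∈ N, μ.degree ≤ d) ∧ N ⊆ boundedMonomials a ∧
      (∀ i, FVector N i = FVector M i) ∧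
      ∀ x y, w x < w y → ∀ μ ∈ N, ∀ s ≤ μ x, shiftTo x y μ s ∈ N := by
  classical
  set B := (Finsupp.finite_of_degree_le (σ := σ) d).toFinset with hB
  have hmemB : ∀ μ, μ ∈ B ↔ μ.degree ≤ d := fun μ => by simp [hB]
  set A : Set (Set (σ →₀ ℕ)) := {N | IsMulticomplex N ∧ (∀ μ ∈ N, μ.degree ≤ d) ∧
    N ⊆ boundedMonomials a ∧ ∀ i, FVector N i = FVector M i} with hA
  have hfin : A.Finite := (Finsupp.finite_of_degree_le (σ := σ) d).finite_subsets.subset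
    fun N hN => hN.2.1
  -- Extremal choice: if a move to a heavier variable left `N`, compressing that pair would strictly
  -- increase the total weight.
  obtain ⟨N, hN, hmax⟩ := Set.exists_max_image A
    (fun N => ∑ μ ∈ B with μ ∈ N, Finsupp.weight w μ) hfin ⟨M, hM, hMd, hMa, fun _ => rfl⟩
  refine ⟨N, hN.1, hN.2.1, hN.2.2.1, hN.2.2.2, fun x y hxy μ hμ s hs => ?_⟩
  have hne : x ≠ y := fun h => hxy.ne (congrArg w h)
  rcases hs.eq_or_lt with rfl | hs
  · rwa [shiftTo_self hne]
  by_contra hcon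
  have hbij := bijOn_compressMap (M := N) hne
  have hdeg : ∀ κ ∈ compress N x y, κ.degree ≤ d := by
    intro κ hκ
    obtain ⟨ν, hν, rfl⟩ := hbij.surjOn hκ
    rw [degree_compressMap hne]
    exact hN.2.1 ν hν
  have hC : compress N x y ∈ A := ⟨isMulticomplex_compress hN.1 hne, hdeg,
    compress_subset_boundedMonomials hne (hw y (by omega)) hN.2.2.1,
    fun i => (FVector_compress hne i).trans (hN.2.2.2 i)⟩
  refine (hmax _ hC).not_gt ?_
  have hsum : ∑ κ ∈ B with κ ∈ compress N x y, Finsupp.weight w κ =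
      ∑ ν ∈ B with ν ∈ N, Finsupp.weight w (compressMap N x y ν) := by
    symm
    refine Finset.sum_nbij (compressMap N x y) (fun ν hν => ?_) (fun ν hν ν' hν' h => ?_)
      (fun κ hκ => ?_) fun _ _ => rfl
    · have := hbij.mapsTo (Finset.mem_filter.1 hν).2
      exact Finset.mem_filter.2 ⟨(hmemB _).2 (hdeg _ this), this⟩
    · exact hbij.injOn (Finset.mem_filter.1 hν).2 (Finset.mem_filter.1 hν').2 h
    · obtain ⟨ν, hν, rfl⟩ := hbij.surjOn (Finset.mem_filter.1 hκ).2
      exact ⟨ν, Finset.mem_filter.2 ⟨(hmemB _).2 (hN.2.1 ν hν), hν⟩, rfl⟩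
  have hwt := fun ν => weight_shiftTo hne w ν (slotCount_le (M := N) (x := x) (y := y) ν (ν x))
  change _ < _
  rw [hsum]
  refine Finset.sum_lt_sum (fun ν _ => ?_)
    ⟨μ, Finset.mem_filter.2 ⟨(hmemB _).2 (hN.2.1 μ hμ), hμ⟩, ?_⟩
  · have := hwt ν
    have := Nat.mul_le_mul_left (ν x - slotCount N x y ν (ν x)) hxy.le
    rw [compressMap]
    omega
  -- The missing monomial is an unoccupied position below `μ x`, so compression really moves `μ`.
  · have hlt : slotCount N x y μ (μ x) < μ x := by
      refine (slotCount_le μ _).lt_of_ne fun h => hcon ?_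
      exact Nat.count_iff_forall.1 h s hs
    have := hwt μ
    have := Nat.mul_lt_mul_of_pos_left hxy (Nat.sub_pos_of_lt hlt)
    rw [compressMap]
    omega

end compress

/-! ### Cutting a chain by gaps -/

theorem exists_card_filter_lt_eq {α : Type*} [LinearOrder α] (T : Finset α) (k : ℕ)
    (hk : k < T.card) : ∃ x ∈ T, (T.filter (x < ·)).card = k := by
  induction T using Finset.induction_on_max generalizing k with
  | empty => simp at hk
  | insert a s ha ih =>
    have has : a ∉ s := fun h => (ha a h).false
    rw [Finset.card_insert_of_notMem has] at hk
    cases k with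
    | zero =>
      refine ⟨a, Finset.mem_insert_self _ _, ?_⟩
      rw [Finset.card_eq_zero, Finset.filter_eq_empty_iff]
      intro y hy
      rcases Finset.mem_insert.1 hy with rfl | hy
      · exact lt_irrefl _
      · exact (ha y hy).not_gt
    | succ k =>
      obtain ⟨x, hx, hcard⟩ := ih k (by omega)
      refine ⟨x, Finset.mem_insert_of_mem hx, ?_⟩
      rw [Finset.filter_insert, if_pos (ha x hx), Finset.card_insert_of_notMem, hcard]
      exact fun h => has (Finset.mem_filter.1 h).1

/-- A finite chain contains `r` gaps which cut it into runs of prescribed lengths. -/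
theorem exists_gaps {α : Type*} [LinearOrder α] (U : Finset α) (c : ℕ → ℕ) (r : ℕ)
    (hU : ∑ t ∈ Finset.range r, c t + r ≤ U.card) :
    ∃ G ⊆ U, G.card = r ∧
      ∀ t < r, ((U \ G).filter fun u => (G.filter (u < ·)).card = t).card = c t := by
  induction r with
  | zero => exact ⟨∅, by simp⟩
  | succ r ih =>
    rw [Finset.sum_range_succ] at hU
    obtain ⟨G, hGU, hGr, hG⟩ := ih (by omega)
    have hlow : ∀ u, (G.filter (u < ·)).card = r ↔ ∀ h ∈ G, u < h := fun u => by
      rw [← hGr, Finset.card_filter_eq_iff]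
    have hle : ∀ u, (G.filter (u < ·)).card ≤ r := fun u => hGr ▸ Finset.card_filter_le _ _
    set T := (U \ G).filter fun u => (G.filter (u < ·)).card = r with hT
    -- `T` is the run below all gaps chosen so far. The earlier runs and gaps take up exactly `∑ c t
    -- + r` elements of `U`, leaving at least `c r + 1`: the next run and its closing gap.
    have hTcard : c r < T.card := by
      have h₁ := Finset.card_eq_sum_card_fiberwise (s := U \ G) (t := Finset.range (r + 1))
        (f := fun u => (G.filter (u < ·)).card)
        (fun u _ => Finset.mem_coe.2 (Finset.mem_range_succ_iff.2 (hle u)))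
      have h₂ : ∑ t ∈ Finset.range r, ((U \ G).filter fun u => (G.filter (u < ·)).card = t).card =
          ∑ t ∈ Finset.range r, c t :=
        Finset.sum_congr rfl fun t ht => hG t (Finset.mem_range.1 ht)
      rw [Finset.sum_range_succ, h₂, Finset.card_sdiff_of_subset hGU, ← hT] at h₁
      have := Finset.card_le_card hGU
      omega
    obtain ⟨g, hgT, hg⟩ := exists_card_filter_lt_eq T (c r) hTcard
    obtain ⟨hgUG, hgr⟩ := Finset.mem_filter.1 hgT
    obtain ⟨hgU, hgG⟩ := Finset.mem_sdiff.1 hgUG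
    have hgl := (hlow g).1 hgr
    have hcount : ∀ u, ((insert g G).filter (u < ·)).card =
        (G.filter (u < ·)).card + if u < g then 1 else 0 := fun u => by
      rw [Finset.filter_insert]
      split_ifs
      · rw [Finset.card_insert_of_notMem fun h => hgG (Finset.mem_filter.1 h).1]
      · rfl
    have hlt : ∀ u, u < g → (G.filter (u < ·)).card = r := fun u hu =>
      (hlow u).2 fun h hh => hu.trans (hgl h hh)
    refine ⟨insert g G, Finset.insert_subset hgU hGU,
      by rw [Finset.card_insert_of_notMem hgG, hGr], fun t ht => ?_⟩
    rcases Nat.lt_succ_iff_lt_or_eq.1 ht with ht | rfl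
    · rw [← hG t ht]
      congr 1
      ext u
      have := hlt u
      have := hle u
      simp only [Finset.mem_filter, Finset.mem_sdiff, Finset.mem_insert, hcount]
      constructor
      · rintro ⟨⟨h₁, h₂⟩, h₃⟩
        refine ⟨⟨h₁, fun h => h₂ (Or.inr h)⟩, ?_⟩
        split_ifs at h₃ with h <;> grind
      · rintro ⟨⟨h₁, h₂⟩, h₃⟩
        have hug : u ≠ g := by rintro rfl; omega
        refine ⟨⟨h₁, by tauto⟩, ?_⟩
        split_ifs with h <;> grind
    · rw [← hg]
      congr 1
      ext u
      have := hlt u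
      simp only [hT, Finset.mem_filter, Finset.mem_sdiff, Finset.mem_insert, hcount]
      constructor
      · rintro ⟨⟨h₁, h₂⟩, h₃⟩
        split_ifs at h₃ with h
        · have := this h
          omega
        · exact ⟨⟨⟨h₁, fun h => h₂ (Or.inr h)⟩, h₃⟩,
            lt_of_le_of_ne (not_lt.1 h) fun h' => h₂ (Or.inl h'.symm)⟩
      · rintro ⟨⟨⟨h₁, h₂⟩, h₃⟩, h₄⟩
        exact ⟨⟨h₁, by rintro (rfl | h); exacts [lt_irrefl _ h₄, h₂ h]⟩, by
          rw [if_neg h₄.not_gt, add_zero, h₃]⟩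

/-! ### Facets and their monomials -/

section blocks

/-- `F` contains none of the blocks with index different from `⊥`. -/
def MissesBlocks {V : Type*} {m : ℕ} (b : V → WithBot (Fin m)) (F : Finset V) : Prop :=
  ∀ i : Fin m, ∃ x, x ∉ F ∧ b x = i

variable {V : Type*} [LinearOrder V] {m : ℕ} (b : V → WithBot (Fin m))

/-- The vertex `u` lies in the unrestricted block `⊥` or below some non-element of `F` in its own
block. -/
def IsFree (F : Finset V) (u : V) : Prop :=
  b u = ⊥ ∨ ∃ x, x ∉ F ∧ u < x ∧ b x = b u

noncomputable instance (F : Finset V) : DecidablePred (IsFree b F) := Classical.decPred _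

variable {b} in
theorem exists_block_of_not_isFree {F : Finset V} {u : V} (h : ¬ IsFree b F u) :
    ∃ i : Fin m, b u = i := by
  obtain ⟨i, hi⟩ := WithBot.ne_bot_iff_exists.1 fun h' => h (Or.inl h')
  exact ⟨i, hi.symm⟩

variable {b} in
-- Freeness of `u` depends only on the part of the set strictly above `u`; this makes comparison at
-- the largest differing vertex possible.
theorem isFree_congr {F G : Finset V} {w u : V} (h : ∀ y, w < y → (y ∈ F ↔ y ∈ G)) (hu : w ≤ u) :
    IsFree b F u ↔ IsFree b G u := by
  refine or_congr Iff.rfl (exists_congr fun x => ?_)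
  constructor
  · rintro ⟨h₁, h₂, h₃⟩
    exact ⟨fun h' => h₁ ((h x (hu.trans_lt h₂)).2 h'), h₂, h₃⟩
  · rintro ⟨h₁, h₂, h₃⟩
    exact ⟨fun h' => h₁ ((h x (hu.trans_lt h₂)).1 h'), h₂, h₃⟩

variable [Fintype V]

/-- The free non-elements of `F`. -/
noncomputable def gaps (F : Finset V) : Finset V :=
  Finset.univ.filter fun u => u ∉ F ∧ IsFree b F u

/-- The number of gaps of `F` above `u`. -/
noncomputable def gapsAbove (F : Finset V) (u : V) : ℕ :=
  ((gaps b F).filter (u < ·)).card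

/-- The parts of the restriction set of `F`, indexed by the variables: the free elements with
exactly `t` gaps above them, and the elements above the last non-element of the `i`-th block. -/
noncomputable def restrictionPart (r : ℕ) (F : Finset V) : Fin r ⊕ Fin m → Finset V
  | .inl t => F.filter fun u => IsFree b F u ∧ gapsAbove b F u = t
  | .inr i => F.filter fun u => b u = i ∧ ¬ IsFree b F u

/-- The restriction set of `F`. -/
noncomputable def restrictionSet (F : Finset V) : Finset V :=
  F.filter fun u => IsFree b F u → ∃ g ∈ gaps b F, g < u

/-- The monomial which corresponds to `F`. -/
noncomputable def restrictionMonomial (r : ℕ) (F : Finset V) : (Fin r ⊕ Fin m) →₀ ℕ :=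
  Finsupp.equivFunOnFinite.symm fun z => (restrictionPart b r F z).card

variable {b}

theorem mem_gaps {F : Finset V} {u : V} : u ∈ gaps b F ↔ u ∉ F ∧ IsFree b F u := by
  simp [gaps]

theorem restrictionMonomial_apply (r : ℕ) (F : Finset V) (z : Fin r ⊕ Fin m) :
    restrictionMonomial b r F z = (restrictionPart b r F z).card := rfl

theorem mem_restrictionPart_inl {r : ℕ} {F : Finset V} {t : Fin r} {u : V} :
    u ∈ restrictionPart b r F (.inl t) ↔ u ∈ F ∧ IsFree b F u ∧ gapsAbove b F u = t := by
  simp [restrictionPart]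

theorem mem_restrictionPart_inr {r : ℕ} {F : Finset V} {i : Fin m} {u : V} :
    u ∈ restrictionPart b r F (.inr i) ↔ u ∈ F ∧ b u = i ∧ ¬ IsFree b F u := by
  simp [restrictionPart]

theorem gapsAbove_lt_iff {F : Finset V} {u : V} (hu : u ∈ F) :
    gapsAbove b F u < (gaps b F).card ↔ ∃ g ∈ gaps b F, g < u := by
  rw [gapsAbove, (Finset.card_filter_le _ _).lt_iff_ne, Ne, Finset.card_filter_eq_iff]
  push Not
  refine exists_congr fun g => and_congr_right fun hg => ?_
  refine (le_iff_eq_or_lt.trans (or_iff_right ?_))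
  rintro rfl
  exact (mem_gaps.1 hg).1 hu

theorem gapsAbove_lt_gapsAbove {F : Finset V} {u g : V} (hug : u < g) (hg : g ∈ gaps b F) :
    gapsAbove b F g < gapsAbove b F u := by
  refine Finset.card_lt_card ((Finset.ssubset_iff_of_subset fun y hy => ?_).2 ⟨g, ?_, ?_⟩)
  · rw [Finset.mem_filter] at hy ⊢
    exact ⟨hy.1, hug.trans hy.2⟩
  · simp [hg, hug]
  · simp

theorem gapsAbove_congr {F G : Finset V} {w u : V} (h : ∀ y, w < y → (y ∈ F ↔ y ∈ G))
    (hu : w ≤ u) : gapsAbove b F u = gapsAbove b G u := by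
  rw [gapsAbove, gapsAbove]
  congr 1
  ext y
  simp only [Finset.mem_filter, mem_gaps]
  refine and_congr_left fun hy => ?_
  have hwy := hu.trans_lt hy
  rw [h y hwy, isFree_congr h hwy.le]

theorem exists_max_nonmem {F : Finset V} (hF : MissesBlocks b F) (i : Fin m) :
    ∃ x, x ∉ F ∧ b x = i ∧ ∀ y, y ∉ F → b y = i → y ≤ x := by
  obtain ⟨x, hx, hmax⟩ := Finset.exists_max_image
    (Finset.univ.filter fun x => x ∉ F ∧ b x = i) id ((hF i).imp fun x hx => by simpa using hx)
  simp only [Finset.mem_filter, Finset.mem_univ, true_and, id] at hx hmax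
  exact ⟨x, hx.1, hx.2, fun y h₁ h₂ => hmax y ⟨h₁, h₂⟩⟩

/-- The non-elements that are not gaps are exactly the topmost missing vertices of the `m` blocks.
-/
theorem card_gaps_add {F : Finset V} (hF : MissesBlocks b F) :
    (gaps b F).card + m + F.card = Fintype.card V := by
  choose h hhF hhb hhmax using exists_max_nonmem hF
  have hinj : Function.Injective h := fun i j hij => by
    have := hhb i
    rw [hij, hhb j] at this
    exact (WithBot.coe_injective this).symm
  have hfree : Fᶜ.filter (IsFree b F) = gaps b F := by
    ext u; simp [mem_gaps]
  have hlast : Fᶜ.filter (fun u => ¬ IsFree b F u) = Finset.univ.image h := by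
    ext u
    simp only [Finset.mem_filter, Finset.mem_compl, Finset.mem_image, Finset.mem_univ, true_and]
    constructor
    · rintro ⟨h₁, h₂⟩
      obtain ⟨i, hi⟩ := exists_block_of_not_isFree h₂
      refine ⟨i, le_antisymm (not_lt.1 fun hlt => h₂ (Or.inr ⟨h i, hhF i, hlt, ?_⟩))
        (hhmax i u h₁ hi)⟩
      rw [hhb, hi]
    · rintro ⟨i, rfl⟩
      refine ⟨hhF i, ?_⟩
      rintro (h' | ⟨x, hx, hlt, hb⟩)
      · simp [hhb] at h'
      · exact (hhmax i x hx (hb.trans (hhb i))).not_gt hlt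
  have := Finset.card_filter_add_card_filter_not (s := Fᶜ) (IsFree b F)
  rw [hfree, hlast, Finset.card_image_of_injective _ hinj, Finset.card_univ, Fintype.card_fin]
    at this
  rw [this, Finset.card_compl_add_card]

/-- The parts partition the restriction set: a free element has a gap below it exactly when fewer
than all `r` gaps lie above it. -/
theorem degree_restrictionMonomial {r : ℕ} {F : Finset V} (hr : (gaps b F).card = r) :
    (restrictionMonomial b r F).degree = (restrictionSet b F).card := by
  have hunion : restrictionSet b F = Finset.univ.biUnion (restrictionPart b r F) := by
    ext u
    simp only [restrictionSet, Finset.mem_filter, Finset.mem_biUnion, Finset.mem_univ, true_and,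
      Sum.exists, mem_restrictionPart_inl, mem_restrictionPart_inr]
    constructor
    · rintro ⟨hu, h⟩
      by_cases hfree : IsFree b F u
      · have := (gapsAbove_lt_iff hu).2 (h hfree)
        exact Or.inl ⟨⟨_, hr ▸ this⟩, hu, hfree, rfl⟩
      · obtain ⟨i, hi⟩ := exists_block_of_not_isFree hfree
        exact Or.inr ⟨i, hu, hi, hfree⟩
    · rintro (⟨t, hu, hfree, ht⟩ | ⟨i, hu, -, hfree⟩)
      · exact ⟨hu, fun _ => (gapsAbove_lt_iff hu).1 (by rw [ht, hr]; exact t.2)⟩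
      · exact ⟨hu, fun h => absurd h hfree⟩
  rw [hunion, Finset.card_biUnion, Finsupp.degree_eq_sum]
  · rfl
  · rintro (t | i) - (t' | i') - hne <;> refine Finset.disjoint_left.2 fun u hu hu' => hne ?_ <;>
      simp only [mem_restrictionPart_inl, mem_restrictionPart_inr] at hu hu'
    · exact congrArg _ (Fin.ext (hu.2.2.symm.trans hu'.2.2))
    · exact absurd hu.2.1 hu'.2.2
    · exact absurd hu'.2.1 hu.2.2
    · exact congrArg _ (WithBot.coe_injective (hu.2.1.symm.trans hu'.2.1))

/-- If `G` preceded `F`, the largest differing vertex `w` would lie in `F` outside its restriction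
set, hence be free with no gap below. Below `w`, `F` then misses at most one vertex per block, and
only in blocks before that of `w`; `G` misses at least as many there and also `w`, contradicting
equal cardinality. -/
theorem toColex_le_of_restrictionSet_subset (hb : Monotone b) {F G : Finset V}
    (hG : MissesBlocks b G) (hcard : F.card = G.card) (h : restrictionSet b F ⊆ G) :
    toColex F ≤ toColex G := by
  by_contra! hlt
  obtain ⟨w, hw, hagree⟩ := Finset.Colex.lt_iff_exists_filter_lt.1 hlt
  obtain ⟨hwF, hwG⟩ := Finset.mem_sdiff.1 hw
  have hagree' : ∀ y, w < y → (y ∈ F ↔ y ∈ G) := fun y hy => by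
    simpa [hy] using (Finset.ext_iff.1 hagree y).symm
  have hwR : ¬ (IsFree b F w → ∃ g ∈ gaps b F, g < w) := fun h' =>
    hwG (h (Finset.mem_filter.2 ⟨hwF, h'⟩))
  push Not at hwR
  obtain ⟨hfree, hnogap⟩ := hwR
  have hblock : ∀ x, x ∉ F → x < w → ¬ IsFree b F x ∧ b x < b w := by
    intro x hx hxw
    have hx' : ¬ IsFree b F x := fun h' => (hnogap x (mem_gaps.2 ⟨hx, h'⟩)).not_gt hxw
    refine ⟨hx', (hb hxw.le).lt_of_ne fun heq => hx' ?_⟩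
    rcases hfree with h' | ⟨y, hy, hwy, hyb⟩
    · exact Or.inl (heq.trans h')
    · exact Or.inr ⟨y, hy, hxw.trans hwy, hyb.trans heq.symm⟩
  have hex : ∀ x, ∃ x', x ∉ F → x < w → x' ∉ G ∧ b x' = b x := by
    intro x
    by_cases hx : x ∉ F ∧ x < w
    · obtain ⟨i, hi⟩ := exists_block_of_not_isFree (hblock x hx.1 hx.2).1
      obtain ⟨x', hx', hbx'⟩ := hG i
      exact ⟨x', fun _ _ => ⟨hx', hbx'.trans hi.symm⟩⟩
    · exact ⟨x, fun h₁ h₂ => absurd ⟨h₁, h₂⟩ hx⟩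
  choose φ hφ using hex
  have hφw : ∀ x, x ∉ F → x < w → φ x < w := by
    intro x hx hxw
    by_contra! hcon
    have := hb hcon
    rw [(hφ x hx hxw).2] at this
    exact this.not_gt (hblock x hx hxw).2
  -- Non-elements above `w` are common to both sets; one below `w` goes to a vertex of its block
  -- missing from `G`, which stays below `w` because blocks are intervals.
  have hle : (Fᶜ).card ≤ (Gᶜ.erase w).card := by
    refine Finset.card_le_card_of_injOn (fun x => if x < w then φ x else x) (fun x hx => ?_)
      fun x hx y hy hxy => ?_
    · have hx := Finset.mem_compl.1 hx
      simp only [Finset.mem_coe, Finset.mem_erase, Finset.mem_compl]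
      split_ifs with hxw
      · exact ⟨(hφw x hx hxw).ne, (hφ x hx hxw).1⟩
      · have hne : x ≠ w := fun h' => hx (h' ▸ hwF)
        have hwx := lt_of_le_of_ne (not_lt.1 hxw) hne.symm
        exact ⟨hne, fun h' => hx ((hagree' x hwx).2 h')⟩
    · have hx := Finset.mem_compl.1 hx
      have hy := Finset.mem_compl.1 hy
      simp only at hxy
      split_ifs at hxy with hxw hyw hyw
      · have hbxy : b x = b y := by rw [← (hφ x hx hxw).2, hxy, (hφ y hy hyw).2]
        by_contra hne
        rcases lt_or_gt_of_ne hne with hlt | hlt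
        · exact (hblock x hx hxw).1 (Or.inr ⟨y, hy, hlt, hbxy.symm⟩)
        · exact (hblock y hy hyw).1 (Or.inr ⟨x, hx, hlt, hbxy⟩)
      · exact absurd (hxy ▸ hφw x hx hxw) hyw
      · exact absurd (hxy ▸ hφw y hy hyw) hxw
      · exact hxy
  have hwG' : w ∈ Gᶜ := Finset.mem_compl.2 hwG
  rw [Finset.card_erase_of_mem hwG'] at hle
  have hpos := Finset.card_pos.2 ⟨w, hwG'⟩
  have h₁ := Finset.card_add_card_compl F
  have h₂ := Finset.card_add_card_compl G
  omega

/-- At the largest differing vertex `w`, in `G` but not `F`, the part that receives `w` in `G` has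
in `F` only elements above `w`: anything lower would see `w` as one more gap, or become free because
of it. So that part strictly grows. -/
theorem restrictionMonomial_ne_of_lt {r : ℕ} {F G : Finset V} (hr : (gaps b F).card = r)
    (hlt : toColex F < toColex G) : restrictionMonomial b r F ≠ restrictionMonomial b r G := by
  obtain ⟨w, hw, hagree⟩ := Finset.Colex.lt_iff_exists_filter_lt.1 hlt
  obtain ⟨hwG, hwF⟩ := Finset.mem_sdiff.1 hw
  have hagree' : ∀ y, w < y → (y ∈ F ↔ y ∈ G) := fun y hy => by
    simpa [hy] using Finset.ext_iff.1 hagree y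
  suffices ∃ z, restrictionPart b r F z ⊂ restrictionPart b r G z by
    obtain ⟨z, hz⟩ := this
    exact fun h => (Finset.card_lt_card hz).ne (DFunLike.congr_fun h z)
  by_cases hfree : IsFree b F w
  · have hgap : w ∈ gaps b F := mem_gaps.2 ⟨hwF, hfree⟩
    have ht : gapsAbove b F w < r := by
      rw [← hr]
      refine Finset.card_lt_card (Finset.filter_ssubset.2 ⟨w, hgap, lt_irrefl _⟩)
    refine ⟨.inl ⟨_, ht⟩, (Finset.ssubset_iff_of_subset fun u hu => ?_).2 ⟨w, ?_, ?_⟩⟩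
    · rw [mem_restrictionPart_inl] at hu ⊢
      have hwu : w < u := by
        by_contra! hcon
        rcases hcon.eq_or_lt with rfl | hcon
        · exact hwF hu.1
        · exact (gapsAbove_lt_gapsAbove hcon hgap).ne' hu.2.2
      rwa [← hagree' u hwu, ← isFree_congr hagree' hwu.le, ← gapsAbove_congr hagree' hwu.le]
    · rw [mem_restrictionPart_inl, ← isFree_congr hagree' le_rfl,
        ← gapsAbove_congr hagree' le_rfl]
      exact ⟨hwG, hfree, rfl⟩
    · exact fun h => hwF (mem_restrictionPart_inl.1 h).1
  · obtain ⟨i, hi⟩ := exists_block_of_not_isFree hfree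
    refine ⟨.inr i, (Finset.ssubset_iff_of_subset fun u hu => ?_).2 ⟨w, ?_, ?_⟩⟩
    · rw [mem_restrictionPart_inr] at hu ⊢
      have hwu : w < u := by
        by_contra! hcon
        rcases hcon.eq_or_lt with rfl | hcon
        · exact hwF hu.1
        · exact hu.2.2 (Or.inr ⟨w, hwF, hcon, hi.trans hu.2.1.symm⟩)
      rwa [← hagree' u hwu, ← isFree_congr hagree' hwu.le]
    · rw [mem_restrictionPart_inr, ← isFree_congr hagree' le_rfl]
      exact ⟨hwG, hi, hfree⟩
    · exact fun h => hwF (mem_restrictionPart_inr.1 h).1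

theorem restrictionMonomial_injOn (b : V → WithBot (Fin m)) (r : ℕ) :
    Set.InjOn (restrictionMonomial b r) {F | (gaps b F).card = r} := by
  intro F hF G hG h
  by_contra hne
  rcases lt_or_gt_of_ne (fun h' => hne (toColex_inj.1 h') : toColex F ≠ toColex G) with hlt | hlt
  · exact restrictionMonomial_ne_of_lt hF hlt h
  · exact restrictionMonomial_ne_of_lt hG hlt h.symm

end blocks

/-! ### Exchanges of vertices and their effect on monomials -/

theorem exists_eq_shiftTo {σ V : Type*} [Finite σ] [DecidableEq V] {P Q : σ → Finset V}
    {μ ν : σ →₀ ℕ} (hμ : ∀ z, μ z = (P z).card) (hν : ∀ z, ν z = (Q z).card) {x y : σ}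
    (hxy : x ≠ y) {A B : Finset V} (hAB : A.card = B.card) (hA : A ⊆ P x)
    (hB : Disjoint (P y) B) (hQx : Q x = P x \ A) (hQy : Q y = P y ∪ B)
    (hQ : ∀ z, z ≠ x → z ≠ y → Q z = P z) : ∃ s ≤ μ x, ν = shiftTo x y μ s := by
  have hcard := Finset.card_sdiff_of_subset hA
  have hle := Finset.card_le_card hA
  refine ⟨ν x, by rw [hμ, hν, hQx, hcard]; omega, ?_⟩
  ext z
  by_cases hzx : z = x
  · rw [hzx, shiftTo_apply_left]
  by_cases hzy : z = y
  · rw [hzy, shiftTo_apply_right hxy, hν, hν, hμ, hμ, hQy, hQx, Finset.card_union_of_disjoint hB,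
      hcard]
    omega
  · rw [shiftTo_apply_of_ne hzx hzy, hν, hμ, hQ z hzx hzy]

/-- The weights which order the variables: unbounded variables are ordered by their index and are
larger than the bounded ones. -/
def variableWeight (r m : ℕ) : Fin r ⊕ Fin m → ℕ :=
  Sum.elim (fun t => t + 1) fun _ => 0

section exchange

variable {V : Type*} [LinearOrder V]

theorem card_insert_erase {F : Finset V} {v g : V} (hv : v ∈ F) (hg : g ∉ F) :
    (insert g (F.erase v)).card = F.card := by
  rw [Finset.card_insert_of_notMem fun h => hg (Finset.mem_of_mem_erase h),
    Finset.card_erase_add_one hv]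

theorem toColex_insert_erase_lt {F : Finset V} {v g : V} (hv : v ∈ F) (hgv : g < v) :
    toColex (insert g (F.erase v)) < toColex F := by
  refine Finset.Colex.lt_iff_exists_filter_lt.2 ⟨v, ?_, ?_⟩
  · simp [hv, hgv.ne']
  · ext u
    simp only [Finset.mem_filter, Finset.mem_insert, Finset.mem_erase]
    constructor
    · rintro ⟨rfl | h, hu⟩
      · exact absurd hu hgv.not_gt
      · exact ⟨h.2, hu⟩
    · exact fun ⟨h, hu⟩ => ⟨Or.inr ⟨hu.ne', h⟩, hu⟩

variable [Fintype V] {m : ℕ} {b : V → WithBot (Fin m)}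

/-- Exchange `v` for the nearest gap `g` below it. Both are free, so freeness is unchanged
everywhere. The gap moves from `g` up to `v`, so the free elements that end up in `[g, v)` see one
more gap: exponent moves from `x_t` to `x_{t+1}`, or is lost if `t + 1 = r`. -/
theorem exists_exchange_of_isFree {r : ℕ} {F : Finset V} (hF : MissesBlocks b F)
    (hr : (gaps b F).card = r) {v : V} (hv : v ∈ F) (hfree : IsFree b F v)
    (hgap : ∃ g ∈ gaps b F, g < v) :
    ∃ g < v, g ∉ F ∧ MissesBlocks b (insert g (F.erase v)) ∧
      (restrictionMonomial b r (insert g (F.erase v)) ≤ restrictionMonomial b r F ∨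
        ∃ x y, variableWeight r m x < variableWeight r m y ∧
          ∃ s ≤ restrictionMonomial b r F x, restrictionMonomial b r (insert g (F.erase v)) =
            shiftTo x y (restrictionMonomial b r F) s) := by
  obtain ⟨g, hg, hmax⟩ := Finset.exists_max_image ((gaps b F).filter (· < v)) id
    (hgap.imp fun g hg => Finset.mem_filter.2 hg)
  simp only [Finset.mem_filter, id, and_imp] at hg hmax
  obtain ⟨hgF, hgfree⟩ := mem_gaps.1 hg.1
  obtain ⟨hgg, hgv⟩ := hg
  set G := insert g (F.erase v) with hG
  have hmemG : ∀ u, u ∈ G ↔ u = g ∨ u ≠ v ∧ u ∈ F := fun u => by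
    rw [hG, Finset.mem_insert, Finset.mem_erase]
  have hfreeG : ∀ u, IsFree b G u ↔ IsFree b F u := by
    intro u
    constructor
    · rintro (h | ⟨x, hx, hux, hxu⟩)
      · exact Or.inl h
      · by_cases hxv : x = v
        · subst hxv
          rcases hfree with h | ⟨y, hy, hxy, hyx⟩
          · exact Or.inl (hxu.symm.trans h)
          · exact Or.inr ⟨y, hy, hux.trans hxy, hyx.trans hxu⟩
        · exact Or.inr ⟨x, fun h => hx ((hmemG x).2 (Or.inr ⟨hxv, h⟩)), hux, hxu⟩
    · rintro (h | ⟨x, hx, hux, hxu⟩)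
      · exact Or.inl h
      · by_cases hxg : x = g
        · subst hxg
          rcases hgfree with h | ⟨y, hy, hxy, hyx⟩
          · exact Or.inl (hxu.symm.trans h)
          · exact Or.inr ⟨y, by rw [hmemG]; grind, hux.trans hxy, hyx.trans hxu⟩
        · exact Or.inr ⟨x, by rw [hmemG]; tauto, hux, hxu⟩
  have hgapsG : gaps b G = insert v ((gaps b F).erase g) := by
    ext u
    simp only [mem_gaps, hfreeG, hmemG, Finset.mem_insert, Finset.mem_erase]
    grind
  have hvgap : v ∉ gaps b F := fun h => (mem_gaps.1 h).1 hv
  have habove : ∀ u, gapsAbove b G u = gapsAbove b F u + if g ≤ u ∧ u < v then 1 else 0 := by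
    intro u
    rw [gapsAbove, gapsAbove, hgapsG]
    rcases lt_or_ge u g with hug | hug
    · rw [if_neg fun h => h.1.not_gt hug, Finset.filter_insert, if_pos (hug.trans hgv),
        Finset.filter_erase, Finset.card_insert_of_notMem (by simp [hvgap]),
        Finset.card_erase_add_one (by simp [hgg, hug]), add_zero]
    · rw [Finset.filter_insert, Finset.filter_erase, Finset.erase_eq_of_notMem
        (by simp [hug])]
      split_ifs with h₁ h₂ h₂
      · exact Finset.card_insert_of_notMem (by simp [hvgap])
      · exact absurd ⟨hug, h₁⟩ h₂
      · exact absurd h₂.2 h₁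
      · rfl
  have hconst : ∀ u, g ≤ u → u ≤ v → gapsAbove b F u = gapsAbove b F v := by
    intro u hgu huv
    rw [gapsAbove, gapsAbove]
    congr 1
    ext y
    simp only [Finset.mem_filter]
    refine and_congr_right fun hy => ⟨fun huy => ?_, huv.trans_lt⟩
    by_contra! hyv
    have : y < v := hyv.lt_of_ne fun h => hvgap (h ▸ hy)
    exact (hmax y hy this).not_gt (hgu.trans_lt huy)
  have ht : gapsAbove b F v < r := hr ▸ (gapsAbove_lt_iff hv).2 hgap
  refine ⟨g, hgv, hgF, fun i => ?_, ?_⟩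
  · obtain ⟨x, hx, hxi⟩ := hF i
    by_cases hxg : x = g
    · subst hxg
      rcases hgfree with h | ⟨y, hy, hxy, hyx⟩
      · simp [h] at hxi
      · exact ⟨y, by rw [hmemG]; grind, hyx.trans hxi⟩
    · exact ⟨x, by rw [hmemG]; tauto, hxi⟩
  have hinr : ∀ i, restrictionPart b r G (.inr i) = restrictionPart b r F (.inr i) := by
    intro i
    ext u
    simp only [mem_restrictionPart_inr, hmemG, hfreeG]
    grind
  have hne : ∀ t : Fin r, (t : ℕ) ≠ gapsAbove b F v → (t : ℕ) ≠ gapsAbove b F v + 1 →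
      restrictionPart b r G (.inl t) = restrictionPart b r F (.inl t) := by
    intro t h₁ h₂
    ext u
    have := hconst u
    simp only [mem_restrictionPart_inl, hmemG, hfreeG, habove]
    grind
  -- `A` leaves the part of `v`; the equally large `insert g (A.erase v)` enters the next one.
  set A := F.filter fun u => IsFree b F u ∧ g < u ∧ u ≤ v with hA
  have hsame : restrictionPart b r G (.inl ⟨_, ht⟩) = restrictionPart b r F (.inl ⟨_, ht⟩) \ A := by
    ext u
    have := hconst u
    simp only [mem_restrictionPart_inl, hmemG, hfreeG, habove, Finset.mem_sdiff, hA,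
      Finset.mem_filter]
    grind
  by_cases ht' : gapsAbove b F v + 1 < r
  · right
    refine ⟨.inl ⟨_, ht⟩, .inl ⟨_, ht'⟩, by simp [variableWeight],
      exists_eq_shiftTo (restrictionMonomial_apply r F) (restrictionMonomial_apply r G)
        (by simp) (A := A) (B := insert g (A.erase v)) ?_ ?_ ?_ hsame ?_ ?_⟩
    · rw [card_insert_erase] <;> simp [hA, hv, hfree, hgv]
    · intro u hu
      have := hconst u
      rw [mem_restrictionPart_inl]
      simp only [hA, Finset.mem_filter] at hu
      exact ⟨hu.1, hu.2.1, this hu.2.2.1.le hu.2.2.2⟩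
    · refine Finset.disjoint_left.2 fun u hu hu' => ?_
      have := hconst u
      simp only [mem_restrictionPart_inl, hA, Finset.mem_insert, Finset.mem_erase,
        Finset.mem_filter] at hu hu'
      grind
    · ext u
      have := hconst u
      simp only [mem_restrictionPart_inl, hA, Finset.mem_insert, Finset.mem_erase,
        Finset.mem_filter, Finset.mem_union, hmemG, hfreeG, habove]
      grind
    · rintro (t | i) h₁ h₂
      · refine hne t ?_ ?_
        · rintro h; exact h₁ (congrArg _ (Fin.ext h))
        · rintro h; exact h₂ (congrArg _ (Fin.ext h))
      · exact hinr i
  · left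
    intro z
    rw [restrictionMonomial_apply, restrictionMonomial_apply]
    refine Finset.card_le_card ?_
    rcases z with t | i
    · by_cases h : (t : ℕ) = gapsAbove b F v
      · have : t = ⟨_, ht⟩ := Fin.ext h
        rw [this, hsame]
        exact Finset.sdiff_subset
      · rw [hne t h (by omega)]
    · rw [hinr]

/-- Exchange `v` for the topmost missing vertex `g` of its block `i`. Then `v` becomes the topmost
missing vertex and the elements of `[g, v)` become free while the gaps stay the same: exponent moves
from `y_i` to `x_t`, where `t` counts the gaps above `v`, or is lost if `t` is not below `r`. -/
theorem exists_exchange_of_not_isFree (hb : Monotone b) {r : ℕ} {F : Finset V}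
    (hF : MissesBlocks b F) {v : V} (hv : v ∈ F) (hfree : ¬ IsFree b F v) :
    ∃ g < v, g ∉ F ∧ MissesBlocks b (insert g (F.erase v)) ∧
      (restrictionMonomial b r (insert g (F.erase v)) ≤ restrictionMonomial b r F ∨
        ∃ x y, variableWeight r m x < variableWeight r m y ∧
          ∃ s ≤ restrictionMonomial b r F x, restrictionMonomial b r (insert g (F.erase v)) =
            shiftTo x y (restrictionMonomial b r F) s) := by
  obtain ⟨i, hi⟩ := exists_block_of_not_isFree hfree
  obtain ⟨g, hgF, hgi, hmax⟩ := exists_max_nonmem hF i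
  have hgv : g < v := by
    by_contra! hcon
    refine hfree (Or.inr ⟨g, hgF, hcon.lt_of_ne fun h => hgF (h ▸ hv), hgi.trans hi.symm⟩)
  set G := insert g (F.erase v) with hG
  have hmemG : ∀ u, u ∈ G ↔ u = g ∨ u ≠ v ∧ u ∈ F := fun u => by
    rw [hG, Finset.mem_insert, Finset.mem_erase]
  have hfreei : ∀ u, b u = i → (IsFree b F u ↔ u < g) := by
    intro u hu
    constructor
    · rintro (h | ⟨x, hx, hux, hxu⟩)
      · simp [h] at hu
      · exact hux.trans_le (hmax x hx (hxu.trans hu))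
    · exact fun h => Or.inr ⟨g, hgF, h, hgi.trans hu.symm⟩
  have hfreeG : ∀ u, IsFree b G u ↔ IsFree b F u ∨ b u = i ∧ u < v := by
    intro u
    constructor
    · rintro (h | ⟨x, hx, hux, hxu⟩)
      · exact Or.inl (Or.inl h)
      · by_cases hxv : x = v
        · subst hxv
          exact Or.inr ⟨hxu.symm.trans hi, hux⟩
        · exact Or.inl (Or.inr ⟨x, fun h => hx ((hmemG x).2 (Or.inr ⟨hxv, h⟩)), hux, hxu⟩)
    · rintro ((h | ⟨x, hx, hux, hxu⟩) | ⟨hui, huv⟩)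
      · exact Or.inl h
      · by_cases hxg : x = g
        · subst hxg
          exact Or.inr ⟨v, by rw [hmemG]; grind, hux.trans hgv, hi.trans (hgi.symm.trans hxu)⟩
        · exact Or.inr ⟨x, by rw [hmemG]; tauto, hux, hxu⟩
      · exact Or.inr ⟨v, by rw [hmemG]; grind, huv, hi.trans hui.symm⟩
  have hgapsG : gaps b G = gaps b F := by
    ext u
    have := hmax u
    have := hfreei u
    simp only [mem_gaps, hfreeG, hmemG]
    grind
  have habove : ∀ u, gapsAbove b G u = gapsAbove b F u := fun u => by
    rw [gapsAbove, gapsAbove, hgapsG]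
  -- By monotonicity of `b`, everything between `g` and `v` lies in block `i`, which has no
  -- non-element above `g`.
  have hconst : ∀ u, g ≤ u → u ≤ v → gapsAbove b F u = gapsAbove b F v := by
    intro u hgu huv
    rw [gapsAbove, gapsAbove]
    congr 1
    ext y
    simp only [Finset.mem_filter]
    refine and_congr_right fun hy => ⟨fun huy => ?_, huv.trans_lt⟩
    by_contra! hyv
    have hyi : b y = i :=
      le_antisymm (hi ▸ hb hyv) (hgi ▸ hb (hgu.trans huy.le))
    exact (hmax y (mem_gaps.1 hy).1 hyi).not_gt (hgu.trans_lt huy)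
  refine ⟨g, hgv, hgF, fun j => ?_, ?_⟩
  · obtain ⟨x, hx, hxj⟩ := hF j
    by_cases hxg : x = g
    · subst hxg
      exact ⟨v, by rw [hmemG]; grind, hi.trans (hgi.symm.trans hxj)⟩
    · exact ⟨x, by rw [hmemG]; tauto, hxj⟩
  set A := F.filter fun u => b u = i ∧ g < u ∧ u ≤ v with hA
  have hne : ∀ t : Fin r, (t : ℕ) ≠ gapsAbove b F v →
      restrictionPart b r G (.inl t) = restrictionPart b r F (.inl t) := by
    intro t h
    ext u
    have := hconst u
    have := hfreei u
    simp only [mem_restrictionPart_inl, hmemG, hfreeG, habove]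
    grind
  have hinr : ∀ j, j ≠ i →
      restrictionPart b r G (.inr j) = restrictionPart b r F (.inr j) := by
    intro j hj
    have hj' : (j : WithBot (Fin m)) ≠ i := fun h => hj (WithBot.coe_injective h)
    ext u
    simp only [mem_restrictionPart_inr, hmemG, hfreeG]
    grind
  have hsame : restrictionPart b r G (.inr i) = restrictionPart b r F (.inr i) \ A := by
    ext u
    have := hfreei u
    simp only [mem_restrictionPart_inr, hmemG, hfreeG, Finset.mem_sdiff, hA, Finset.mem_filter]
    grind
  by_cases ht : gapsAbove b F v < r
  · right
    refine ⟨.inr i, .inl ⟨_, ht⟩, by simp [variableWeight],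
      exists_eq_shiftTo (restrictionMonomial_apply r F) (restrictionMonomial_apply r G)
        (by simp) (A := A) (B := insert g (A.erase v)) ?_ ?_ ?_ hsame ?_ ?_⟩
    · rw [card_insert_erase] <;> simp [hA, hv, hi, hgv]
    · intro u hu
      simp only [hA, Finset.mem_filter] at hu
      rw [mem_restrictionPart_inr, hfreei u hu.2.1]
      exact ⟨hu.1, hu.2.1, hu.2.2.1.not_gt⟩
    · refine Finset.disjoint_left.2 fun u hu hu' => ?_
      have := hfreei u
      simp only [mem_restrictionPart_inl, hA, Finset.mem_insert, Finset.mem_erase,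
        Finset.mem_filter] at hu hu'
      grind
    · ext u
      have := hconst u
      have := hfreei u
      simp only [mem_restrictionPart_inl, hA, Finset.mem_insert, Finset.mem_erase,
        Finset.mem_filter, Finset.mem_union, hmemG, hfreeG, habove]
      grind
    · rintro (t | j) h₁ h₂
      · exact hne t fun h => h₂ (congrArg _ (Fin.ext h))
      · exact hinr j fun h => h₁ (congrArg _ h)
  · left
    intro z
    rw [restrictionMonomial_apply, restrictionMonomial_apply]
    refine Finset.card_le_card ?_
    rcases z with t | j
    · rw [hne t (by omega)]
    · by_cases h : j = i
      · rw [h, hsame]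
        exact Finset.sdiff_subset
      · rw [hinr j h]

end exchange

/-! ### Every admissible monomial comes from a facet -/

section surjectivity

variable {V : Type*} [LinearOrder V] [Fintype V] {m : ℕ} {b : V → WithBot (Fin m)}

/-- The exponent of `y_i` fixes the topmost missing vertex `h i` of block `i`, hence the set `U` of
free vertices; the exponents of the `x_t` are the run lengths into which `r` gaps must cut `U`. The
bound on the degree says that `U` is large enough. -/
theorem exists_restrictionMonomial_eq {r d : ℕ} (hV : Fintype.card V = d + m + r)
    (μ : (Fin r ⊕ Fin m) →₀ ℕ) (hd : μ.degree ≤ d)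
    (hμ : ∀ i : Fin m, μ (.inr i) < (Finset.univ.filter fun u => b u = i).card) :
    ∃ F : Finset V, MissesBlocks b F ∧ F.card = d ∧ restrictionMonomial b r F = μ := by
  choose h hh hcard using fun i => exists_card_filter_lt_eq _ _ (hμ i)
  have hhb : ∀ i, b (h i) = i := fun i => (Finset.mem_filter.1 (hh i)).2
  set U := Finset.univ.filter fun u => ∀ i : Fin m, b u = i → u < h i with hU
  have hmemU : ∀ u, u ∈ U ↔ ∀ i : Fin m, b u = i → u < h i := fun u => by simp [hU]
  have hUc : (Uᶜ).card = ∑ i, μ (.inr i) + m := by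
    have hunion : Uᶜ = Finset.univ.biUnion fun i : Fin m =>
        insert (h i) ((Finset.univ.filter fun u => b u = i).filter (h i < ·)) := by
      ext u
      simp only [Finset.mem_compl, hmemU, Finset.mem_biUnion, Finset.mem_univ, true_and,
        Finset.mem_insert, Finset.mem_filter]
      push Not
      refine exists_congr fun i => ?_
      have := hhb i
      grind
    rw [hunion, Finset.card_biUnion]
    · have : ∀ i : Fin m, (insert (h i)
          ((Finset.univ.filter fun u => b u = i).filter (h i < ·))).card = μ (.inr i) + 1 := by
        intro i
        rw [Finset.card_insert_of_notMem (by simp), hcard]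
      simp [this, Finset.sum_add_distrib]
    · rintro i - j - hij
      have hij' : (i : WithBot (Fin m)) ≠ j := fun h => hij (WithBot.coe_injective h)
      refine Finset.disjoint_left.2 fun u hu hu' => ?_
      have := hhb i
      have := hhb j
      simp only [Finset.mem_insert, Finset.mem_filter, Finset.mem_univ, true_and] at hu hu'
      grind
  rw [Finsupp.degree_eq_sum, Fintype.sum_sum_type] at hd
  obtain ⟨G, hGU, hGr, hG⟩ := exists_gaps U
    (fun t => if ht : t < r then μ (.inl ⟨t, ht⟩) else 0) r (by
      have := Finset.card_add_card_compl U
      rw [Finset.sum_range]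
      simp only [Fin.is_lt, dite_true, Fin.eta]
      omega)
  set F := (G ∪ Finset.univ.image h)ᶜ with hF
  have hmemF : ∀ u, u ∈ F ↔ u ∉ G ∧ ∀ i, h i ≠ u := fun u => by simp [hF]
  have hhU : ∀ i, h i ∉ U := fun i hi => ((hmemU _).1 hi i (hhb i)).false
  have hfree : ∀ u, IsFree b F u ↔ u ∈ U := by
    intro u
    rw [hmemU]
    constructor
    · rintro (hu | ⟨x, hx, hux, hxu⟩) i hi
      · simp [hu] at hi
      · rw [hmemF] at hx
        by_cases hxG : x ∈ G
        · exact hux.trans ((hmemU x).1 (hGU hxG) i (hxu.trans hi))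
        · push Not at hx
          obtain ⟨j, rfl⟩ := hx hxG
          have : j = i := WithBot.coe_injective ((hhb j).symm.trans (hxu.trans hi))
          exact this ▸ hux
    · intro hu
      by_cases hbu : b u = ⊥
      · exact Or.inl hbu
      · obtain ⟨i, hi⟩ := WithBot.ne_bot_iff_exists.1 hbu
        exact Or.inr ⟨h i, by simp [hmemF], hu i hi.symm, (hhb i).trans hi⟩
  have hgaps : gaps b F = G := by
    ext u
    rw [mem_gaps, hfree, hmemF]
    constructor
    · rintro ⟨h₁, h₂⟩
      by_contra hu
      exact h₁ ⟨hu, fun i hi => hhU i (hi ▸ h₂)⟩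
    · exact fun hu => ⟨fun h' => h'.1 hu, hGU hu⟩
  have hmiss : MissesBlocks b F := fun i => ⟨h i, by simp [hmemF], hhb i⟩
  refine ⟨F, hmiss, ?_, ?_⟩
  · have := card_gaps_add hmiss
    rw [hgaps] at this
    omega
  · ext z
    rw [restrictionMonomial_apply]
    rcases z with t | i
    · have := hG t t.2
      simp only [Fin.is_lt, dite_true, Fin.eta] at this
      rw [← this]
      congr 1
      ext u
      simp only [mem_restrictionPart_inl, hfree, hmemF, gapsAbove, hgaps, Finset.mem_filter,
        Finset.mem_sdiff]
      have := hhU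
      grind
    · rw [← hcard]
      congr 1
      ext u
      rw [mem_restrictionPart_inr, hfree, hmemF, hmemU]
      simp only [Finset.mem_filter, Finset.mem_univ, true_and]
      constructor
      · rintro ⟨⟨-, h₁⟩, h₂, h₃⟩
        refine ⟨h₂, lt_of_le_of_ne (not_lt.1 fun hlt => h₃ fun j hj => ?_) (h₁ i)⟩
        have : i = j := WithBot.coe_injective (h₂.symm.trans hj)
        exact this ▸ hlt
      · rintro ⟨h₁, h₂⟩
        have hu : ¬ ∀ j : Fin m, b u = j → u < h j := fun h' => (h' i h₁).not_gt h₂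
        refine ⟨⟨fun huG => hu ((hmemU u).1 (hGU huG)), fun j hj => ?_⟩, h₁, hu⟩
        have : j = i := WithBot.coe_injective ((hhb j).symm.trans (by rw [hj, h₁]))
        subst this
        exact h₂.ne hj

end surjectivity

/-! ### The shellable complex of a stable multicomplex -/

section stable

variable {V : Type*} [LinearOrder V] [Fintype V] {m : ℕ} {b : V → WithBot (Fin m)}

open Classical in
/-- The facets whose monomials belong to `M`. -/
noncomputable def monomialFacets (b : V → WithBot (Fin m)) (r d : ℕ)
    (M : Set ((Fin r ⊕ Fin m) →₀ ℕ)) : Finset (Finset V) :=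
  Finset.univ.filter fun F => MissesBlocks b F ∧ F.card = d ∧ restrictionMonomial b r F ∈ M

variable {r d : ℕ} {M : Set ((Fin r ⊕ Fin m) →₀ ℕ)}

theorem mem_monomialFacets {F : Finset V} : F ∈ monomialFacets b r d M ↔
    MissesBlocks b F ∧ F.card = d ∧ restrictionMonomial b r F ∈ M := by
  simp [monomialFacets]

theorem card_gaps_of_mem_monomialFacets (hV : Fintype.card V = d + m + r) {F : Finset V}
    (hF : F ∈ monomialFacets b r d M) : (gaps b F).card = r := by
  obtain ⟨h₁, h₂, -⟩ := mem_monomialFacets.1 hF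
  have := card_gaps_add h₁
  omega

theorem isRestrictionMap_restrictionSet (hb : Monotone b) (hV : Fintype.card V = d + m + r)
    (hM : IsMulticomplex M)
    (hMb : ∀ μ ∈ M, ∀ i : Fin m, μ (.inr i) < (Finset.univ.filter fun u => b u = i).card)
    (hstable : ∀ x y, variableWeight r m x < variableWeight r m y →
      ∀ μ ∈ M, ∀ s ≤ μ x, shiftTo x y μ s ∈ M) :
    IsRestrictionMap (monomialFacets b r d M) d (restrictionSet b) where
  nonempty := by
    have h0 : (0 : (Fin r ⊕ Fin m) →₀ ℕ) ∈ M := hM.1.elim fun μ hμ => hM.2 0 μ zero_le hμ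
    obtain ⟨F, h₁, h₂, h₃⟩ := exists_restrictionMonomial_eq hV 0 (by simp) (hMb 0 h0)
    exact ⟨F, mem_monomialFacets.2 ⟨h₁, h₂, h₃ ▸ h0⟩⟩
  card_eq F hF := (mem_monomialFacets.1 hF).2.1
  subset F _ := Finset.filter_subset _ _
  le_of_subset F hF G hG h := by
    rw [mem_monomialFacets] at hF hG
    exact toColex_le_of_restrictionSet_subset hb hG.1 (hF.2.1.trans hG.2.1.symm) h
  exchange F hF v hv := by
    have hr := card_gaps_of_mem_monomialFacets hV hF
    rw [mem_monomialFacets] at hF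
    obtain ⟨hvF, hv⟩ := Finset.mem_filter.1 hv
    have hex : ∃ g < v, g ∉ F ∧ MissesBlocks b (insert g (F.erase v)) ∧
        (restrictionMonomial b r (insert g (F.erase v)) ≤ restrictionMonomial b r F ∨
          ∃ x y, variableWeight r m x < variableWeight r m y ∧
            ∃ s ≤ restrictionMonomial b r F x, restrictionMonomial b r (insert g (F.erase v)) =
              shiftTo x y (restrictionMonomial b r F) s) := by
      by_cases hfree : IsFree b F v
      · exact exists_exchange_of_isFree hF.1 hr hvF hfree (hv hfree)
      · exact exists_exchange_of_not_isFree hb hF.1 hvF hfree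
    obtain ⟨g, hgv, hgF, hmiss, hmon⟩ := hex
    refine ⟨insert g (F.erase v), mem_monomialFacets.2 ⟨hmiss, ?_, ?_⟩,
      toColex_insert_erase_lt hvF hgv, Finset.subset_insert _ _⟩
    · rw [card_insert_erase hvF hgF, hF.2.1]
    · rcases hmon with hle | ⟨x, y, hxy, s, hs, heq⟩
      · exact hM.2 _ _ hle hF.2.2
      · rw [heq]
        exact hstable x y hxy _ hF.2.2 s hs

/-- The monomial map is a bijection from the chosen facets to `M` that turns the size of the
restriction set into degree. -/
theorem card_filter_restrictionSet (hV : Fintype.card V = d + m + r)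
    (hMd : ∀ μ ∈ M, μ.degree ≤ d)
    (hMb : ∀ μ ∈ M, ∀ i : Fin m, μ (.inr i) < (Finset.univ.filter fun u => b u = i).card)
    (i : ℕ) : ((monomialFacets b r d M).filter fun F => (restrictionSet b F).card = i).card =
      FVector M i := by
  have hinj : Set.InjOn (restrictionMonomial b r)
      ((monomialFacets b r d M).filter fun F => (restrictionSet b F).card = i) :=
    (restrictionMonomial_injOn b r).mono fun F hF =>
      card_gaps_of_mem_monomialFacets hV (Finset.mem_filter.1 hF).1
  rw [FVector, ← Set.ncard_coe_finset, ← hinj.ncard_image]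
  congr 1
  ext μ
  constructor
  · rintro ⟨F, hF, rfl⟩
    obtain ⟨hF, hi⟩ := Finset.mem_filter.1 hF
    exact ⟨(mem_monomialFacets.1 hF).2.2,
      (degree_restrictionMonomial (card_gaps_of_mem_monomialFacets hV hF)).trans hi⟩
  · rintro ⟨hμ, hi⟩
    obtain ⟨F, h₁, h₂, h₃⟩ := exists_restrictionMonomial_eq hV μ (hMd μ hμ) (hMb μ hμ)
    have hF : F ∈ monomialFacets b r d M := mem_monomialFacets.2 ⟨h₁, h₂, h₃ ▸ hμ⟩
    refine ⟨F, Finset.mem_filter.2 ⟨hF, ?_⟩, h₃⟩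
    rw [← degree_restrictionMonomial (card_gaps_of_mem_monomialFacets hV hF), h₃, hi]

end stable

theorem exists_shellable_complex {V α : Type*} [Fintype V] [LinearOrder α] {m r d : ℕ}
    {b : V → WithBot (Fin m)} (pos : V → α) (hpos : Function.Injective pos)
    (hb : ∀ u v, pos u ≤ pos v → b u ≤ b v) (hV : Fintype.card V = d + m + r)
    {M : Set ((Fin r ⊕ Fin m) →₀ ℕ)} (hM : IsMulticomplex M) (hMd : ∀ μ ∈ M, μ.degree ≤ d)
    (hMb : M ⊆ boundedMonomials (Sum.elim (fun _ => ⊤)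
      fun i : Fin m => (((Finset.univ.filter fun u => b u = i).card - 1 : ℕ) : ℕ∞)))
    (hne : ∀ i : Fin m, ∃ u, b u = i) :
    ∃ Γ : PreAbstractSimplicialComplex V, (∀ s ∈ Γ, MissesBlocks b s) ∧ IsShellable Γ d ∧
      ∀ i, hVector Γ d i = (FVector M i : ℤ) := by
  let _ : LinearOrder V := LinearOrder.lift' pos hpos
  -- Only the unbounded variables have positive weight, so compression never pushes exponent into a
  -- bounded variable.
  obtain ⟨N, hN, hNd, hNb, hNM, hstable⟩ := exists_stable_multicomplex hM hMd hMb
    (variableWeight r m) (by rintro (t | i) h <;> simp [variableWeight] at h ⊢)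
  have hNb' : ∀ μ ∈ N, ∀ i : Fin m,
      μ (.inr i) < (Finset.univ.filter fun u => b u = i).card := by
    intro μ hμ i
    have h : μ (.inr i) ≤ _ := Nat.cast_le.1 (hNb hμ (.inr i))
    -- The bound is a truncated difference; nonempty blocks make it a strict inequality.
    have : 0 < (Finset.univ.filter fun u => b u = i).card :=
      Finset.card_pos.2 ((hne i).imp fun u hu => by simpa using hu)
    omega
  have h := isRestrictionMap_restrictionSet (fun u v => hb u v) hV hN hNb' hstable
  refine ⟨generatedComplex (monomialFacets b r d N), ?_, h.isShellable, fun i => ?_⟩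
  · rintro s ⟨-, F, hF, hs⟩ i
    obtain ⟨x, hx, hxi⟩ := (mem_monomialFacets.1 hF).1 i
    exact ⟨x, fun h => hx (hs h), hxi⟩
  · rw [h.hVector_eq, card_filter_restrictionSet hV hNd hNb', hNM]

/-! ### The vertices and faces of `LambdaComplex` -/

section lambda

variable {l m : ℕ} {p : Fin m → ℕ}

/-- The position of a vertex of `Λ(l; p_1, …, p_m)`: its block, with `⊥` for the simplex, followed
by its index within the block. -/
def vertexPosition : Fin l ⊕ (Σ i : Fin m, Fin (p i)) → WithBot (Fin m) ×ₗ ℕ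
  | .inl a => toLex (⊥, (a : ℕ))
  | .inr u => toLex ((u.1 : WithBot (Fin m)), (u.2 : ℕ))

theorem vertexPosition_injective : Function.Injective (vertexPosition (l := l) (p := p)) := by
  rintro (a | ⟨i, j⟩) (a' | ⟨i', j'⟩) h
  · simpa [vertexPosition, Fin.ext_iff] using h
  · simp [vertexPosition] at h
  · simp [vertexPosition] at h
  · simp only [vertexPosition, toLex_inj, Prod.mk.injEq, WithBot.coe_inj] at h
    obtain ⟨rfl, h⟩ := h
    rw [Fin.ext h]

/-- The block of a vertex of `Λ(l; p_1, …, p_m)`. -/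
def vertexBlock (u : Fin l ⊕ (Σ i : Fin m, Fin (p i))) : WithBot (Fin m) :=
  (ofLex (vertexPosition u)).1

theorem vertexBlock_eq_coe {u : Fin l ⊕ (Σ i : Fin m, Fin (p i))} {i : Fin m} :
    vertexBlock u = i ↔ ∃ j, u = .inr ⟨i, j⟩ := by
  constructor
  · rcases u with a | ⟨i', j⟩
    · intro h
      simp [vertexBlock, vertexPosition] at h
    · intro h
      obtain rfl : i' = i := WithBot.coe_injective h
      exact ⟨j, rfl⟩
  · rintro ⟨j, rfl⟩
    rfl

theorem card_vertexBlock_eq (i : Fin m) : (Finset.univ.filter fun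
    u : Fin l ⊕ (Σ i : Fin m, Fin (p i)) => vertexBlock u = i).card = p i := by
  classical
  have : (Finset.univ.filter fun u : Fin l ⊕ (Σ i : Fin m, Fin (p i)) => vertexBlock u = i) =
      Finset.univ.image fun j : Fin (p i) => .inr ⟨i, j⟩ := by
    ext u
    simp [vertexBlock_eq_coe, eq_comm]
  rw [this, Finset.card_image_of_injective, Finset.card_univ, Fintype.card_fin]
  intro j j' h
  simpa using h

theorem isFace_lambdaComplex {s : Finset (Fin l ⊕ (Σ i : Fin m, Fin (p i)))} (hs : s.Nonempty)
    (h : MissesBlocks vertexBlock s) : s ∈ LambdaComplex l p := by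
  refine ⟨hs, s.toLeft.eq_empty_or_nonempty, ?_⟩
  rcases s.toRight.eq_empty_or_nonempty with h' | h'
  · exact Or.inl h'
  refine Or.inr ⟨h', fun i => ?_⟩
  rcases (component s.toRight i).eq_empty_or_nonempty with h'' | h''
  · exact Or.inl h''
  refine Or.inr ⟨h'', fun huniv => ?_⟩
  obtain ⟨x, hx, hxi⟩ := h i
  obtain ⟨j, rfl⟩ := vertexBlock_eq_coe.1 hxi
  have : j ∈ component s.toRight i := huniv ▸ Finset.mem_univ j
  exact hx (by simpa [component] using this)

end lambda

theorem mainTheorem1 (l m n d : ℕ) (p : Fin m → ℕ) (hl : 1 ≤ l) (hp : ∀ i, 2 ≤ p i)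
    (hn : n = l + ∑ i, p i) (hd : d ≤ n - m)
    (M : Set ((Fin (n - d - m) ⊕ Fin m) →₀ ℕ)) (hM : IsMulticomplex M)
    (hMS : M ⊆ boundedMonomials
      (Sum.elim (fun _ => ⊤) (fun i => ((p i - 1 : ℕ) : ℕ∞))))
    (hMd : ∀ μ ∈ M, μ.degree ≤ d) :
    ∃ Γ : PreAbstractSimplicialComplex (Fin l ⊕ (Σ i : Fin m, Fin (p i))),
      Γ ≤ LambdaComplex l p ∧ IsShellable Γ d ∧ ∀ i : ℕ, hVector Γ d i = (FVector M i : ℤ) := by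
  -- With this, the truncated subtractions `n - m` and `n - d - m` are exact.
  have hm : m ≤ ∑ i, p i := by
    simpa using Finset.card_nsmul_le_sum Finset.univ p 1 fun i _ => by have := hp i; omega
  have hV : Fintype.card (Fin l ⊕ (Σ i : Fin m, Fin (p i))) = d + m + (n - d - m) := by
    simp only [Fintype.card_sum, Fintype.card_sigma, Fintype.card_fin]
    omega
  obtain ⟨Γ, hΓ, hshell, hh⟩ := exists_shellable_complex (b := vertexBlock) vertexPosition
    vertexPosition_injective (fun _ _ h => Prod.Lex.monotone_fst _ _ h) hV hM hMd
    (by simpa only [card_vertexBlock_eq] using hMS)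
    fun i => ⟨.inr ⟨i, ⟨0, by have := hp i; omega⟩⟩, rfl⟩
  exact ⟨Γ, fun s hs => isFace_lambdaComplex (Γ.isRelLowerSet_faces hs).1 (hΓ s hs), hshell, hh⟩
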